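/- Let $S$ be a discrete valuation ring with maximal ideal $M_S$ and residue field $\bar S=S/M_S$, let $G$ be a finite group of automorphisms of $S$, let $R=S^G$ be the ring of invariants, and assume that $\bar S$ is separable over the residue field $\bar R=R/(M_S\cap R)$. Let $f\in Z^2(G,S^*)$ and let $T=S^f*G=\bigoplus_{g\in G}SU_g$ be the crossed product, with multiplication $sU_g\,tU_h=s\,g(t)f(g,h)U_{gh}$. Let $\bar f\in Z^2(G,\bar S^*)$ be the image of $f$, let $G_I$ be the inertia group, i.e. the kernel of the action of $G$ on $\bar S$, let $p=\mathrm{char}(\bar S)$, and let $P$ be a Sylow $p$-subgroup of $G_I$ (if $p=0$, then $P$ is trivial and every integer counts as prime to $p$). Let $\bar S^{\bar f}G_I$ be the twisted group algebra formed with the restriction of $\bar f$ to $G_I$, and let $F=\bar S^{\bar f}P\subseteq\bar S^{\bar f}G_I$ be its subalgebra spanned by the $U_\sigma$, $\sigma\in P$. (1) $T$ is hereditary if and only if $\bar S^{\bar f}G_I$ is semisimple, $F$ is a field that is purely inseparable over $\bar S$, and there are an integer $e_0\ge 1$ prime to $p$ and an element $\alpha_0\in\bar S^*$ such that $\bar S^{\bar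 f}G_I\cong F[x]/\langle x^{e_0}-\alpha_0\rangle$ as $\bar S$-algebras. (2) If $T$ is hereditary, then $G_I$ is abelian and there are $\sigma_0\in G_I$, whose order $e_0$ is prime to $p$, and $\alpha_0\in\bar S^*$ such that $G_I=P\times\langle\sigma_0\rangle$ (internal direct product), $F$ is a field, and there is an isomorphism $\bar S^{\bar f}G_I\cong F[x]/\langle x^{e_0}-\alpha_0\rangle$ of $\bar S$-algebras that is the identity on $F$ and sends $U_{\sigma_0}$ to the class of $x$. -/

import Mathlib

noncomputable section

/-- Two-cocycles of a group `G` with values in the unit group `K*` of a commutative ring `K` on which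
`G` acts by ring automorphisms, i.e. the elements of `Z²(G, K*)`. They are not assumed to be
normalized. -/
structure TwoCocycle (G K : Type*) [Group G] [CommRing K] [MulSemiringAction G K] where
  /-- The underlying function. -/
  toFun : G → G → Kˣ
  /-- The cocycle identity `f(gh,j) f(g,h) = g(f(h,j)) f(g,hj)`. -/
  cocycle : ∀ g h j : G, (toFun (g * h) j : K) * (toFun g h : K) =
    (g • (toFun h j : K)) * (toFun g (h * j) : K)

/-- The restriction of a two-cocycle to a subgroup. -/
def TwoCocycle.res {G K : Type*} [Group G] [CommRing K] [MulSemiringAction G K]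
    (f : TwoCocycle G K) (H : Subgroup G) : TwoCocycle H K where
  toFun g h := f.toFun g h
  cocycle g h j := f.cocycle g h j

/-- The (classical) crossed product `K^f * G = ⨁_g K U_g`, with elements written as finite sums
`∑ s_g U_g`. -/
def CrossedProduct {K G : Type*} [CommRing K] [Group G] [MulSemiringAction G K]
    (_f : TwoCocycle G K) : Type _ :=
  G →₀ K

namespace CrossedProduct

section Ring

variable {K G : Type*} [CommRing K] [Group G] [MulSemiringAction G K] (f : TwoCocycle G K)

instance : AddCommGroup (CrossedProduct f) := inferInstanceAs (AddCommGroup (G →₀ K))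

/-- The monomial `s U_g`. -/
def mono (g : G) (s : K) : CrossedProduct f := Finsupp.single g s

/-- The basis element `U_g`. -/
def U (g : G) : CrossedProduct f := mono f g 1

/-- The multiplication determined by `(s U_g) (t U_h) = s g(t) f(g,h) U_{gh}`. -/
instance : Mul (CrossedProduct f) where
  mul a b := Finsupp.sum a fun g s => Finsupp.sum b fun h t =>
    mono f (g * h) (s * (g • t) * (f.toFun g h : K))

/-- The unit `f(1,1)⁻¹ U_1`. -/
instance : One (CrossedProduct f) where
  one := mono f 1 ((f.toFun 1 1)⁻¹ : Kˣ)

theorem mul_def (a b : CrossedProduct f) :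
    a * b = Finsupp.sum a fun g s => Finsupp.sum b fun h t =>
      mono f (g * h) (s * (g • t) * (f.toFun g h : K)) := rfl

theorem one_def : (1 : CrossedProduct f) = mono f 1 ((f.toFun 1 1)⁻¹ : Kˣ) := rfl

theorem mono_zero (g : G) : mono f g 0 = 0 := Finsupp.single_zero g

theorem mono_add (g : G) (s t : K) : mono f g (s + t) = mono f g s + mono f g t :=
  Finsupp.single_add g s t

theorem induction {p : CrossedProduct f → Prop} (a : CrossedProduct f) (h0 : p 0)
    (hadd : ∀ x y, p x → p y → p (x + y)) (hm : ∀ g s, p (mono f g s)) : p a :=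
  Finsupp.induction_linear (motive := p) a h0 hadd hm

protected theorem zero_mul' (a : CrossedProduct f) : 0 * a = 0 := Finsupp.sum_zero_index

protected theorem mul_zero' (a : CrossedProduct f) : a * 0 = 0 := by
  rw [mul_def]
  exact Finset.sum_eq_zero fun g _ => Finsupp.sum_zero_index

protected theorem add_mul' (a b c : CrossedProduct f) : (a + b) * c = a * c + b * c := by
  classical
  refine Finsupp.sum_add_index' (fun g => ?_) (fun g s t => ?_)
  · simp only [zero_mul, mono_zero]
    exact Finset.sum_eq_zero fun _ _ => rfl
  · simp only [add_mul, mono_add]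
    exact Finsupp.sum_add

protected theorem mul_add' (a b c : CrossedProduct f) : a * (b + c) = a * b + a * c := by
  classical
  refine (Finsupp.sum_congr fun g _ => Finsupp.sum_add_index' (fun h => ?_)
    (fun h s t => ?_)).trans Finsupp.sum_add
  · simp [mono_zero]
  · simp only [smul_add, mul_add, add_mul, mono_add]

theorem mono_mul_mono (g h : G) (s t : K) :
    mono f g s * mono f h t = mono f (g * h) (s * (g • t) * (f.toFun g h : K)) := by
  refine (Finsupp.sum_single_index ?_).trans (Finsupp.sum_single_index ?_)
  · simp only [zero_mul, mono_zero]
    exact Finset.sum_eq_zero fun _ _ => rfl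
  · simp [mono_zero]

theorem coe_cocycle_one_left (g : G) : (f.toFun 1 g : K) = (f.toFun 1 1 : K) := by
  have h := f.cocycle 1 1 g
  simp only [one_mul, one_smul] at h
  exact ((f.toFun 1 g).isUnit.mul_left_cancel h).symm

theorem coe_cocycle_one_right (g : G) : (f.toFun g 1 : K) = g • (f.toFun 1 1 : K) := by
  have h := f.cocycle g 1 1
  simp only [mul_one] at h
  exact (f.toFun g 1).isUnit.mul_right_cancel h

protected theorem mul_assoc' (a b c : CrossedProduct f) : a * b * c = a * (b * c) := by
  induction a using CrossedProduct.induction with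
  | h0 => simp only [CrossedProduct.zero_mul']
  | hadd x y hx hy => simp only [CrossedProduct.add_mul', hx, hy]
  | hm g s =>
  induction b using CrossedProduct.induction with
  | h0 => simp only [CrossedProduct.zero_mul', CrossedProduct.mul_zero']
  | hadd x y hx hy => simp only [CrossedProduct.add_mul', CrossedProduct.mul_add', hx, hy]
  | hm h t =>
  induction c using CrossedProduct.induction with
  | h0 => simp only [CrossedProduct.mul_zero']
  | hadd x y hx hy => simp only [CrossedProduct.mul_add', hx, hy]
  | hm j u =>
    simp only [mono_mul_mono, mul_assoc, smul_mul', mul_smul]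
    congr 1
    have := f.cocycle g h j
    linear_combination (s * g • t * g • h • u) * this

protected theorem one_mul' (a : CrossedProduct f) : 1 * a = a := by
  induction a using CrossedProduct.induction with
  | h0 => exact CrossedProduct.mul_zero' f _
  | hadd x y hx hy => rw [CrossedProduct.mul_add', hx, hy]
  | hm g s =>
    rw [one_def, mono_mul_mono, one_mul, one_smul, coe_cocycle_one_left, mul_right_comm,
      Units.inv_mul, one_mul]

protected theorem mul_one' (a : CrossedProduct f) : a * 1 = a := by
  induction a using CrossedProduct.induction with
  | h0 => exact CrossedProduct.zero_mul' f _
  | hadd x y hx hy => rw [CrossedProduct.add_mul', hx, hy]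
  | hm g s =>
    rw [one_def, mono_mul_mono, mul_one, coe_cocycle_one_right, mul_assoc, ← smul_mul',
      Units.inv_mul, smul_one, mul_one]

instance : Ring (CrossedProduct f) where
  zero_mul := CrossedProduct.zero_mul' f
  mul_zero := CrossedProduct.mul_zero' f
  left_distrib := CrossedProduct.mul_add' f
  right_distrib := CrossedProduct.add_mul' f
  mul_assoc := CrossedProduct.mul_assoc' f
  one_mul := CrossedProduct.one_mul' f
  mul_one := CrossedProduct.mul_one' f
  zsmul := fun n a => n • a
  zsmul_zero' := SubNegMonoid.zsmul_zero'
  zsmul_succ' := SubNegMonoid.zsmul_succ'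
  zsmul_neg' := SubNegMonoid.zsmul_neg'
  neg_add_cancel := neg_add_cancel
  sub_eq_add_neg := sub_eq_add_neg

/-- The inclusion of the coefficient ring, `s ↦ s · 1 = s f(1,1)⁻¹ U_1`. -/
def coeffHom : K →+* CrossedProduct f where
  toFun s := mono f 1 (s * ((f.toFun 1 1)⁻¹ : Kˣ))
  map_one' := by rw [one_mul, one_def]
  map_zero' := by rw [zero_mul, mono_zero]
  map_add' s t := by rw [add_mul, mono_add]
  map_mul' s t := by
    rw [mono_mul_mono, one_mul, one_smul]
    congr 1
    have := Units.inv_mul (f.toFun 1 1)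
    linear_combination -(s * t * (((f.toFun 1 1)⁻¹ : Kˣ) : K)) * this

/-- `inclHom` as an additive map. -/
def inclAddHom (H : Subgroup G) : CrossedProduct (f.res H) →+ CrossedProduct f :=
  (Finsupp.mapDomain.addMonoidHom (Subtype.val : H → G) : (H →₀ K) →+ (G →₀ K))

theorem inclAddHom_mono (H : Subgroup G) (h : H) (s : K) :
    inclAddHom f H (mono (f.res H) h s) = mono f h s :=
  Finsupp.mapDomain_single

/-- The inclusion `K^f * H → K^f * G`, `s U_h ↦ s U_h`, of the sub-crossed product graded by a
subgroup `H` of `G`. -/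
def inclHom (H : Subgroup G) : CrossedProduct (f.res H) →+* CrossedProduct f where
  __ := inclAddHom f H
  map_one' := inclAddHom_mono f H 1 _
  map_mul' a b := by
    change inclAddHom f H (a * b) = inclAddHom f H a * inclAddHom f H b
    induction a using CrossedProduct.induction with
    | h0 => rw [zero_mul, map_zero, zero_mul]
    | hadd x y hx hy => rw [add_mul, map_add, map_add, add_mul, hx, hy]
    | hm g s =>
    induction b using CrossedProduct.induction with
    | h0 => rw [mul_zero, map_zero, mul_zero]
    | hadd x y hx hy => rw [mul_add, map_add, map_add, mul_add, hx, hy]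
    | hm h t =>
      rw [mono_mul_mono, inclAddHom_mono, inclAddHom_mono, inclAddHom_mono, mono_mul_mono]
      rfl

end Ring

end CrossedProduct

/-- `G` acts trivially on `K`. -/
class ActsTrivially (G K : Type*) [SMul G K] : Prop where
  smul_eq : ∀ (g : G) (x : K), g • x = x

instance {G K : Type*} [Group G] [CommRing K] [MulSemiringAction G K] [h : ActsTrivially G K]
    (H : Subgroup G) : ActsTrivially H K where
  smul_eq g x := h.smul_eq g.1 x

/-- When `G` acts trivially on `K`, the crossed product is the twisted group algebra `K^f G`, an
algebra over `K`. -/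
instance CrossedProduct.instAlgebra {K G : Type*} [CommRing K] [Group G] [MulSemiringAction G K]
    [hG : ActsTrivially G K] (f : TwoCocycle G K) : Algebra K (CrossedProduct f) :=
  (CrossedProduct.coeffHom f).toAlgebra' fun s a => by
    have hs : CrossedProduct.coeffHom f s =
      CrossedProduct.mono f 1 (s * ((f.toFun 1 1)⁻¹ : Kˣ)) := rfl
    induction a using CrossedProduct.induction with
    | h0 => rw [mul_zero, zero_mul]
    | hadd x y hx hy => rw [mul_add, add_mul, hx, hy]
    | hm g t =>
      rw [hs, CrossedProduct.mono_mul_mono, CrossedProduct.mono_mul_mono, one_mul, mul_one,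
        CrossedProduct.coe_cocycle_one_left f g, CrossedProduct.coe_cocycle_one_right f g,
        hG.smul_eq, hG.smul_eq, hG.smul_eq]
      congr 1
      ring

/-- A ring is hereditary if all its left ideals and all its right ideals are projective modules. -/
def IsHereditaryRing (T : Type*) [Ring T] : Prop :=
  (∀ I : Submodule T T, Module.Projective T I) ∧
    ∀ I : Submodule Tᵐᵒᵖ T, Module.Projective Tᵐᵒᵖ I

/-- The commutative algebra `F[x] / (x^e - a)` over a ring `F` which is a field. -/
abbrev BinomialAlgebra {F : Type*} [Ring F] (hF : IsField F) (e : ℕ) (a : F) : Type _ :=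
  letI : Field F := hF.toField
  AdjoinRoot (Polynomial.X ^ e - Polynomial.C a)

section Residue

variable (S G : Type*) [CommRing S] [IsLocalRing S] [Group G] [MulSemiringAction G S]

/-- The residue field `S̄ = S / M_S` is separable over the residue field `R̄ = R / (M_S ∩ R)` of the
ring of invariants `R = S^G`. -/
def ResiduallySeparable : Prop :=
  Algebra.IsSeparable
    (FixedPoints.subring S G ⧸ (IsLocalRing.maximalIdeal S).under (FixedPoints.subring S G))
    (S ⧸ IsLocalRing.maximalIdeal S)

/-- The inertia group: the kernel of the induced action of `G` on the residue field. -/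
def inertiaGroup : Subgroup G :=
  (MulSemiringAction.toRingAut G (IsLocalRing.ResidueField S)).ker

instance : ActsTrivially (inertiaGroup S G) (IsLocalRing.ResidueField S) where
  smul_eq g x := RingEquiv.congr_fun (MonoidHom.mem_ker.mp g.2) x

variable {S G}

/-- The image `f̄` of `f` under `Z²(G, S*) → Z²(G, S̄*)`. -/
def TwoCocycle.residue (f : TwoCocycle G S) : TwoCocycle G (IsLocalRing.ResidueField S) where
  toFun g h := Units.map (IsLocalRing.residue S).toMonoidHom (f.toFun g h)
  cocycle g h j := by
    simpa using congrArg (IsLocalRing.residue S) (f.cocycle g h j)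

/-- The twisted group algebra `S̄^f̄ G_I`. -/
abbrev InertiaAlgebra (f : TwoCocycle G S) : Type _ :=
  CrossedProduct (f.residue.res (inertiaGroup S G))

/-- The twisted group algebra `S̄^f̄ P`, for a subgroup `P` of the inertia group `G_I`. -/
abbrev SubInertiaAlgebra (f : TwoCocycle G S) (P : Subgroup (inertiaGroup S G)) : Type _ :=
  CrossedProduct ((f.residue.res (inertiaGroup S G)).res P)

end Residue

end

/-! Sufficiency comes from the semisimplicity of `S̄^f̄ G_I`. The group `G / G_I` acts faithfully on
`S̄`, so by independence of characters `S̄` contains an element of trace one, and Maschke averaging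
makes all of `S̄^f̄ G` semisimple. For a uniformizer `π` this ring is `T / Tπ`, where `π` is regular
and normal in `T`. The resolution `0 → T → T → T / Tπ → 0` then shows that a submodule of a
projective module `V` that contains `π ^ k V` is projective (`projective_of_pow_smul_le`). A left
ideal is free over `S`; averaging an `S`-linear section of a `T`-free cover places it, together with
a complement, between a free module and a `π ^ k`-multiple of it. Right ideals are handled through
the opposite crossed product.

For necessity, heredity descends to `Λ = S^f * P`, a bimodule summand of `T`. Over an algebraic
closure of `S̄` the cocycle of the `p`-group `P` splits, which gives a character `χ` of `Λ`;
elements outside its kernel `J` are invertible. Since `J` is projective, Nakayama forces `J = Λx`.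
Residual separability makes `S` totally ramified over `S^P`, so the determinantal norm of a nonunit
of `Λ`, being invariant, is divisible by `π ^ |P|`, while `π` has norm of valuation exactly `|P|`.
Hence in `π = yx` the factor `y` is invertible, `J = Λπ`, and `χ` embeds `S̄^f̄ P = Λ / Λπ` in the
algebraic closure (`ker_character_eq_bot`). The `|P|`-th powers of its values lie in `S̄`, so the
image is a purely inseparable field.

Finally, the tame character `g ↦ gπ / π` of `G_I` has kernel `P` and cyclic image, so `P` has a
complement generated by some `σ₀` of order prime to `p`. Conjugation by `U_σ₀` is an automorphism of
a purely inseparable extension, hence trivial. So `S̄^f̄ G_I` is commutative, `G_I` is abelian, and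
adjoining `U_σ₀` to `F` gives the binomial algebra. Semisimplicity is Maschke's theorem for the
index of `P`. -/

noncomputable section

/-! ### Coefficients, monomial units and the universal property -/

namespace CrossedProduct

section Basics

variable {K G : Type*} [CommRing K] [Group G] [MulSemiringAction G K] (f : TwoCocycle G K)

/-- The coefficient of `U_g`. -/
def coeff (g : G) : CrossedProduct f →+ K := Finsupp.applyAddHom (M := K) g

variable {f} in
@[ext]
theorem ext_coeff {a b : CrossedProduct f} (h : ∀ g, coeff f g a = coeff f g b) : a = b :=
  Finsupp.ext h

theorem coeff_mono [DecidableEq G] (g h : G) (s : K) :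
    coeff f g (mono f h s) = if h = g then s else 0 :=
  Finsupp.single_apply

theorem coeff_mono_self (g : G) (s : K) : coeff f g (mono f g s) = s := by
  classical simp [coeff_mono]

theorem coeff_mono_of_ne {g h : G} (hgh : h ≠ g) (s : K) : coeff f g (mono f h s) = 0 := by
  classical simp [coeff_mono, hgh]

theorem sum_mono_coeff [Fintype G] (a : CrossedProduct f) : ∑ g, mono f g (coeff f g a) = a := by
  classical
  ext h
  simp [map_sum, coeff_mono]

theorem coeffHom_apply (s : K) : coeffHom f s = mono f 1 (s * ((f.toFun 1 1)⁻¹ : Kˣ)) := rfl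

theorem coeffHom_mul_mono (s t : K) (g : G) : coeffHom f s * mono f g t = mono f g (s * t) := by
  rw [coeffHom_apply, mono_mul_mono, one_mul, one_smul, coe_cocycle_one_left]
  congr 1
  have := Units.inv_mul (f.toFun 1 1)
  linear_combination (s * t) * this

theorem mono_mul_coeffHom (s t : K) (g : G) :
    mono f g t * coeffHom f s = mono f g (t * g • s) := by
  rw [coeffHom_apply, mono_mul_mono, mul_one, coe_cocycle_one_right, mul_assoc, ← smul_mul',
    mul_assoc, Units.inv_mul, mul_one]

theorem coeff_coeffHom_mul (s : K) (a : CrossedProduct f) (g : G) :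
    coeff f g (coeffHom f s * a) = s * coeff f g a := by
  classical
  induction a using CrossedProduct.induction with
  | h0 => simp
  | hadd x y hx hy => simp [mul_add, hx, hy]
  | hm h t => simp [coeffHom_mul_mono, coeff_mono]

theorem coeff_mul_coeffHom (s : K) (a : CrossedProduct f) (g : G) :
    coeff f g (a * coeffHom f s) = coeff f g a * g • s := by
  classical
  induction a using CrossedProduct.induction with
  | h0 => simp
  | hadd x y hx hy => simp [add_mul, hx, hy]
  | hm h t =>
    rw [mono_mul_coeffHom, coeff_mono, coeff_mono]
    split_ifs with H
    · rw [H]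
    · simp

theorem mono_eq (g : G) (s : K) : mono f g s = coeffHom f s * U f g := by
  rw [U, coeffHom_mul_mono, mul_one]

theorem U_mul_U (g h : G) : U f g * U f h = coeffHom f (f.toFun g h) * U f (g * h) := by
  rw [← mono_eq, U, U, mono_mul_mono]
  simp

theorem U_mul_coeffHom (g : G) (s : K) : U f g * coeffHom f s = coeffHom f (g • s) * U f g := by
  rw [← mono_eq, U, mono_mul_coeffHom, one_mul]

theorem U_one : U f 1 = coeffHom f (f.toFun 1 1) := by
  rw [coeffHom_apply, Units.mul_inv, U]

/-- Monomials with a unit coefficient are invertible. -/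
def monoUnit (g : G) (s : Kˣ) : (CrossedProduct f)ˣ where
  val := mono f g s
  inv := mono f g⁻¹ (g⁻¹ • ((s⁻¹ : Kˣ) : K) * ((f.toFun g⁻¹ g)⁻¹ : Kˣ) * ((f.toFun 1 1)⁻¹ : Kˣ))
  val_inv := by
    rw [mono_mul_mono, mul_inv_cancel, one_def]
    congr 1
    -- The inverse was found by solving for a left inverse. This instance of the cocycle identity
    -- turns `f(g,g⁻¹)` into `f(1,1)⁻¹ · g f(g⁻¹,g) · g f(1,1)`, which makes it a right inverse too.
    have h := f.cocycle g g⁻¹ g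
    rw [mul_inv_cancel, inv_mul_cancel, coe_cocycle_one_left f g, coe_cocycle_one_right f g] at h
    simp only [smul_mul', smul_inv_smul]
    have h1 : g • ((f.toFun g⁻¹ g : Kˣ) : K) * g • (((f.toFun g⁻¹ g)⁻¹ : Kˣ) : K) = 1 := by
      rw [← smul_mul', Units.mul_inv, smul_one]
    have h2 : g • ((f.toFun 1 1 : Kˣ) : K) * g • (((f.toFun 1 1)⁻¹ : Kˣ) : K) = 1 := by
      rw [← smul_mul', Units.mul_inv, smul_one]
    have h3 := Units.mul_inv (f.toFun 1 1)
    have h4 := Units.mul_inv s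
    set a := g • ((f.toFun g⁻¹ g : Kˣ) : K)
    set a' := g • (((f.toFun g⁻¹ g)⁻¹ : Kˣ) : K)
    set b := g • ((f.toFun 1 1 : Kˣ) : K)
    set b' := g • (((f.toFun 1 1)⁻¹ : Kˣ) : K)
    set c' := (((f.toFun 1 1)⁻¹ : Kˣ) : K)
    set c := ((f.toFun 1 1 : Kˣ) : K)
    set x := ((f.toFun g g⁻¹ : Kˣ) : K)
    have hx : x = c' * (a * b) := by linear_combination (-x) * h3 + c' * h
    rw [hx]
    linear_combination (b * b' * a * a' * c') * h4 + (a * a' * c') * h2 + c' * h1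
  inv_val := by
    rw [mono_mul_mono, inv_mul_cancel, one_def]
    congr 1
    have h1 : g⁻¹ • ((s⁻¹ : Kˣ) : K) * g⁻¹ • (s : K) = 1 := by
      rw [← smul_mul', Units.inv_mul, smul_one]
    have h2 := Units.inv_mul (f.toFun g⁻¹ g)
    linear_combination ((((f.toFun g⁻¹ g)⁻¹ : Kˣ) : K) * (f.toFun g⁻¹ g : K)) *
      (((f.toFun 1 1)⁻¹ : Kˣ) : K) * h1 + (((f.toFun 1 1)⁻¹ : Kˣ) : K) * h2

theorem coe_monoUnit (g : G) (s : Kˣ) : (monoUnit f g s : CrossedProduct f) = mono f g s := rfl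

theorem coe_monoUnit_one (g : G) : (monoUnit f g 1 : CrossedProduct f) = U f g := rfl

theorem isUnit_U (g : G) : IsUnit (U f g) := ⟨monoUnit f g 1, rfl⟩

/-- The universal property of the crossed product. -/
def liftHom {A : Type*} [Ring A] (i : K →+* A) (w : G → A) (h1 : w 1 = i (f.toFun 1 1))
    (hi : ∀ g s, w g * i s = i (g • s) * w g)
    (hw : ∀ g h, w g * w h = i (f.toFun g h) * w (g * h)) : CrossedProduct f →+* A where
  toFun a := Finsupp.sum a fun g s => i s * w g
  map_zero' := Finsupp.sum_zero_index
  map_add' a b := Finsupp.sum_add_index' (by simp) (by simp [add_mul])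
  map_one' := by
    refine (Finsupp.sum_single_index (by simp)).trans ?_
    rw [h1, ← map_mul, Units.inv_mul, map_one]
  map_mul' a b := by
    let φ : CrossedProduct f →+ A :=
      { toFun := fun a => Finsupp.sum a fun g s => i s * w g
        map_zero' := Finsupp.sum_zero_index
        map_add' := fun a b => Finsupp.sum_add_index' (by simp) (by simp [add_mul]) }
    have hφ : ∀ g s, φ (mono f g s) = i s * w g := fun g s =>
      Finsupp.sum_single_index (h := fun g s => i s * w g) (by simp)
    change φ (a * b) = φ a * φ b
    induction a using CrossedProduct.induction with
    | h0 => simp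
    | hadd x y hx hy => rw [add_mul, map_add, map_add, add_mul, hx, hy]
    | hm g s =>
    induction b using CrossedProduct.induction with
    | h0 => simp
    | hadd x y hx hy => rw [mul_add, map_add, map_add, mul_add, hx, hy]
    | hm h t =>
      rw [mono_mul_mono, hφ, hφ, hφ, mul_assoc (i s), ← mul_assoc (w g), hi, mul_assoc (i (g • t)),
        hw, map_mul, map_mul]
      simp only [mul_assoc]

theorem liftHom_mono {A : Type*} [Ring A] (i : K →+* A) (w : G → A) (h1 hi hw) (g : G) (s : K) :
    liftHom f i w h1 hi hw (mono f g s) = i s * w g :=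
  Finsupp.sum_single_index (h := fun g s => i s * w g) (by simp)

theorem liftHom_coeffHom {A : Type*} [Ring A] (i : K →+* A) (w : G → A) (h1 hi hw) (s : K) :
    liftHom f i w h1 hi hw (coeffHom f s) = i s := by
  rw [coeffHom_apply, liftHom_mono, h1, ← map_mul, mul_assoc, Units.inv_mul, mul_one]

theorem inclHom_mono (H : Subgroup G) (h : H) (s : K) :
    inclHom f H (mono (f.res H) h s) = mono f h s := inclAddHom_mono f H h s

theorem inclHom_U (H : Subgroup G) (h : H) : inclHom f H (U (f.res H) h) = U f h :=
  inclHom_mono f H h 1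

theorem inclHom_coeffHom (H : Subgroup G) (s : K) :
    inclHom f H (coeffHom (f.res H) s) = coeffHom f s := inclHom_mono f H 1 _

theorem inclHom_injective (H : Subgroup G) : Function.Injective (inclHom f H) :=
  Finsupp.mapDomain_injective Subtype.val_injective

end Basics

end CrossedProduct

/-! ### Opposite crossed products and change of coefficients -/

/-- The two-cocycle describing the opposite of a crossed product. -/
def TwoCocycle.op {G K : Type*} [Group G] [CommRing K] [MulSemiringAction G K]
    (f : TwoCocycle G K) : TwoCocycle G K where
  toFun g h := Units.map (MulSemiringAction.toRingHom G K (g * h)).toMonoidHom (f.toFun h⁻¹ g⁻¹)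
  cocycle g h j := by
    have h := congrArg ((g * h * j) • ·) (f.cocycle j⁻¹ h⁻¹ g⁻¹)
    simp only [smul_mul', smul_smul] at h
    simp only [RingHom.toMonoidHom_eq_coe, Units.coe_map, MonoidHom.coe_coe,
      MulSemiringAction.toRingHom_apply, smul_smul, mul_inv_rev]
    simp only [mul_assoc, mul_inv_cancel, mul_one] at h ⊢
    linear_combination -h

theorem TwoCocycle.op_apply {G K : Type*} [Group G] [CommRing K] [MulSemiringAction G K]
    (f : TwoCocycle G K) (g h : G) : (f.op.toFun g h : K) = (g * h) • (f.toFun h⁻¹ g⁻¹ : K) := rfl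

namespace CrossedProduct

open MulOpposite

variable {K G : Type*} [CommRing K] [Group G] [MulSemiringAction G K] (f : TwoCocycle G K)

/-- The comparison map from the crossed product of the opposite cocycle to the opposite ring. -/
def opHom : CrossedProduct f.op →+* (CrossedProduct f)ᵐᵒᵖ :=
  liftHom f.op ((RingEquiv.toOpposite K).toRingHom |> (coeffHom f).op.comp)
    (fun g => op (U f g⁻¹))
    (by
      simp only [inv_one, U_one]
      simp [TwoCocycle.op_apply])
    (fun g s => by
      apply unop_injective
      simp [U_mul_coeffHom])
    (fun g h => by
      apply unop_injective
      simp [U_mul_U, TwoCocycle.op_apply, U_mul_coeffHom, smul_smul])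

theorem opHom_mono (g : G) (s : K) : opHom f (mono f.op g s) = op (mono f g⁻¹ (g⁻¹ • s)) := by
  rw [opHom, liftHom_mono]
  apply unop_injective
  simp [U_mul_coeffHom, mono_eq]

theorem coeff_opHom (a : CrossedProduct f.op) (g : G) :
    coeff f g (unop (opHom f a)) = g • coeff f.op g⁻¹ a := by
  classical
  induction a using CrossedProduct.induction with
  | h0 => simp
  | hadd x y hx hy => simp [hx, hy]
  | hm h s =>
    rw [opHom_mono, unop_op, coeff_mono, coeff_mono]
    by_cases H : h = g⁻¹
    · subst H; simp
    · have : h⁻¹ ≠ g := fun h' => H (by rw [← h', inv_inv])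
      simp [H, this]

theorem opHom_bijective [Finite G] : Function.Bijective (opHom f) := by
  cases nonempty_fintype G
  constructor
  · rw [injective_iff_map_eq_zero]
    intro a ha
    ext g
    have := coeff_opHom f a g⁻¹
    rw [ha] at this
    simpa using (smul_eq_zero_iff_eq (g⁻¹ : G)).1 (by simpa using this.symm)
  · intro b
    refine ⟨∑ g, mono f.op g⁻¹ (g⁻¹ • coeff f g (unop b)), ?_⟩
    rw [map_sum]
    simp only [opHom_mono, inv_inv, smul_inv_smul]
    apply unop_injective
    conv_rhs => rw [← sum_mono_coeff f (unop b)]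
    simp

/-- The opposite of a crossed product is a crossed product. -/
def opEquiv [Finite G] : CrossedProduct f.op ≃+* (CrossedProduct f)ᵐᵒᵖ :=
  RingEquiv.ofBijective (opHom f) (opHom_bijective f)

/-- The map of crossed products induced by an equivariant ring homomorphism compatible with the
cocycles. -/
def mapHom {L : Type*} [CommRing L] [MulSemiringAction G L] (f' : TwoCocycle G L) (i : K →+* L)
    (hi : ∀ (g : G) s, i (g • s) = g • i s) (hf : ∀ g h, (f'.toFun g h : L) = i (f.toFun g h)) :
    CrossedProduct f →+* CrossedProduct f' :=
  liftHom f ((coeffHom f').comp i) (U f') (by rw [U_one, hf]; rfl)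
    (fun g s => by simp [U_mul_coeffHom, hi]) (fun g h => by simp [U_mul_U, hf])

section

variable {L : Type*} [CommRing L] [MulSemiringAction G L] (f' : TwoCocycle G L) (i : K →+* L)
  (hi : ∀ (g : G) s, i (g • s) = g • i s) (hf : ∀ g h, (f'.toFun g h : L) = i (f.toFun g h))

theorem mapHom_mono (g : G) (s : K) : mapHom f f' i hi hf (mono f g s) = mono f' g (i s) := by
  rw [mapHom, liftHom_mono, mono_eq]; rfl

theorem coeff_mapHom (g : G) (a : CrossedProduct f) :
    coeff f' g (mapHom f f' i hi hf a) = i (coeff f g a) := by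
  classical
  induction a using CrossedProduct.induction with
  | h0 => simp
  | hadd x y hx hy => simp [hx, hy]
  | hm h s => rw [mapHom_mono, coeff_mono, coeff_mono]; split_ifs <;> simp

theorem mapHom_surjective [Finite G] (h : Function.Surjective i) :
    Function.Surjective (mapHom f f' i hi hf) := by
  cases nonempty_fintype G
  intro b
  choose r hr using h
  refine ⟨∑ g, mono f g (r (coeff f' g b)), ?_⟩
  rw [map_sum]
  simp only [mapHom_mono, hr]
  exact sum_mono_coeff f' b

end

/-- Reduction of a crossed product over a local ring modulo the maximal ideal. -/
def reduction {S : Type*} [CommRing S] [IsLocalRing S] [MulSemiringAction G S]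
    (f : TwoCocycle G S) : CrossedProduct f →+* CrossedProduct f.residue :=
  mapHom f f.residue (IsLocalRing.residue S) (fun _ _ => rfl) (fun _ _ => rfl)

end CrossedProduct

/-! ### Averaging over cosets and Maschke's theorem -/

namespace CrossedProduct

section Average

variable {K G : Type*} [CommRing K] [Group G] [MulSemiringAction G K] (f : TwoCocycle G K)
variable {X Y : Type*} [AddCommGroup X] [AddCommGroup Y] [Module (CrossedProduct f) X]
  [Module (CrossedProduct f) Y]

/-- The conjugate of an additive map `θ`, multiplied by a scalar `c`, under a unit. -/
def conj (θ : X →+ Y) (c : K) (u : (CrossedProduct f)ˣ) (x : X) : Y :=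
  (u : CrossedProduct f) • coeffHom f c • θ ((u⁻¹ : (CrossedProduct f)ˣ) • x)

theorem conj_smul (θ : X →+ Y) (c : K) (u m : (CrossedProduct f)ˣ) (x : X) :
    conj f θ c u (m • x) = (m : CrossedProduct f) • conj f θ c (m⁻¹ * u) x := by
  simp only [conj, mul_inv_rev, inv_inv, smul_smul, Units.smul_def, Units.val_mul]
  simp [← mul_assoc]

variable {f} {H : Subgroup G} {θ : X →+ Y} {c : K}

/-- The extra factor cancels: `θ` commutes with monomials graded by `H`, and `c`, being fixed by
`H`, commutes with them as well. So the conjugate by `U_g` depends only on the coset of `g`, and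
unit coefficients do not matter. -/
theorem conj_mul_monoUnit (hθ : ∀ h ∈ H, ∀ (s : K) x, θ (mono f h s • x) = mono f h s • θ x)
    (hc : ∀ h ∈ H, h • c = c) (u : (CrossedProduct f)ˣ) {h : G} (hh : h ∈ H) (s : Kˣ) :
    conj f θ c (u * monoUnit f h s) = conj f θ c u := by
  ext x
  have key : ∀ y : X, mono f h s • θ ((monoUnit f h s)⁻¹ • y) = θ y := fun y => by
    rw [← hθ h hh, ← coe_monoUnit, ← Units.smul_def, smul_inv_smul]
  have comm : mono f h (s : K) * coeffHom f c = coeffHom f c * mono f h s := by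
    rw [mono_mul_coeffHom, coeffHom_mul_mono, hc h hh, mul_comm]
  simp only [conj, Units.val_mul, mul_smul, mul_inv_rev, coe_monoUnit]
  rw [smul_smul (mono f h s), comm, mul_smul, key]

theorem monoUnit_mul (g h : G) : ∃ s : Kˣ,
    monoUnit f (g * h) 1 = monoUnit f g 1 * monoUnit f h s := by
  refine ⟨Units.map (MulSemiringAction.toRingHom G K g⁻¹).toMonoidHom (f.toFun g h)⁻¹, ?_⟩
  ext1
  rw [Units.val_mul, coe_monoUnit, coe_monoUnit, coe_monoUnit, mono_mul_mono]
  simp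

theorem conj_monoUnit_eq_out (hθ : ∀ h ∈ H, ∀ (s : K) x, θ (mono f h s • x) = mono f h s • θ x)
    (hc : ∀ h ∈ H, h • c = c) (g : G) :
    conj f θ c (monoUnit f g 1) = conj f θ c (monoUnit f (g : G ⧸ H).out 1) := by
  obtain ⟨h, hh⟩ := QuotientGroup.mk_out_eq_mul H g
  obtain ⟨s, hs⟩ := monoUnit_mul (f := f) g h
  rw [hh, hs, conj_mul_monoUnit hθ hc _ h.2]

theorem conj_coeffHom_smul (hθ : ∀ h ∈ H, ∀ (s : K) x, θ (mono f h s • x) = mono f h s • θ x)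
    (g : G) (s : K) (x : X) :
    conj f θ c (monoUnit f g 1) (coeffHom f s • x) =
      coeffHom f s • conj f θ c (monoUnit f g 1) x := by
  have e1 : ((monoUnit f g 1)⁻¹ : (CrossedProduct f)ˣ) * coeffHom f s =
      coeffHom f (g⁻¹ • s) * ((monoUnit f g 1)⁻¹ : (CrossedProduct f)ˣ) := by
    rw [Units.inv_mul_eq_iff_eq_mul, ← mul_assoc, coe_monoUnit_one, U_mul_coeffHom, smul_inv_smul,
      mul_assoc, ← coe_monoUnit_one, Units.mul_inv, mul_one]
  simp only [conj, Units.smul_def, smul_smul]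
  rw [e1, mul_smul (coeffHom f (g⁻¹ • s)), coeffHom_apply f (g⁻¹ • s), hθ 1 H.one_mem,
    ← coeffHom_apply, smul_smul, coe_monoUnit_one, mul_assoc, ← map_mul, mul_comm c, map_mul, ← mul_assoc, U_mul_coeffHom,
    smul_inv_smul, mul_assoc]

variable (f) in
/-- The average over `G ⧸ H` of the conjugates of `c θ`. -/
theorem exists_average [Fintype (G ⧸ H)]
    (hθ : ∀ h ∈ H, ∀ (s : K) x, θ (mono f h s • x) = mono f h s • θ x)
    (hc : ∀ h ∈ H, h • c = c) :
    ∃ θ' : X →ₗ[CrossedProduct f] Y, ∀ x,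
      θ' x = ∑ q : G ⧸ H, conj f θ c (monoUnit f q.out 1) x := by
  have hadd : ∀ x y, ∑ q : G ⧸ H, conj f θ c (monoUnit f q.out 1) (x + y) =
      ∑ q : G ⧸ H, conj f θ c (monoUnit f q.out 1) x +
        ∑ q : G ⧸ H, conj f θ c (monoUnit f q.out 1) y := fun x y => by
    simp [conj, Finset.sum_add_distrib]
  refine ⟨{ toFun := fun x => ∑ q : G ⧸ H, conj f θ c (monoUnit f q.out 1) x
            map_add' := hadd, map_smul' := fun t x => ?_ }, fun x => rfl⟩
  dsimp only [RingHom.id_apply]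
  induction t using CrossedProduct.induction with
  | h0 => simp [conj]
  | hadd a b ha hb => rw [add_smul, hadd, ha, hb, add_smul]
  | hm k s =>
    rw [mono_eq, mul_smul]
    simp only [conj_coeffHom_smul hθ]
    rw [← Finset.smul_sum, mul_smul]
    congr 1
    rw [← coe_monoUnit_one, ← Units.smul_def]
    simp only [conj_smul]
    rw [← Finset.smul_sum]
    -- `U_k` permutes the cosets. The chosen representative of `k⁻¹ q` need not be `k⁻¹ * q.out`,
    -- and `U_k⁻¹ U_{q.out}` is `U_{k⁻¹ q.out}` only up to a unit coefficient; `conj_mul_monoUnit`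
    -- absorbs both discrepancies.
    refine congrArg _ (Fintype.sum_equiv (MulAction.toPerm k⁻¹) _ _ fun q => ?_)
    rw [MulAction.toPerm_apply]
    have hq : k⁻¹ • q = ((k⁻¹ * q.out : G) : G ⧸ H) := by
      conv_lhs => rw [← QuotientGroup.out_eq' q]
      rfl
    rw [hq, ← conj_monoUnit_eq_out hθ hc]
    obtain ⟨r, hr⟩ := monoUnit_mul (f := f) k (k⁻¹ * q.out)
    rw [mul_inv_cancel_left] at hr
    rw [hr, inv_mul_cancel_left]
    obtain ⟨r', hr'⟩ : ∃ r' : Kˣ, monoUnit f (k⁻¹ * q.out) r =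
        monoUnit f (k⁻¹ * q.out) 1 * monoUnit f 1 r' := by
      refine ⟨Units.map (MulSemiringAction.toRingHom G K (k⁻¹ * q.out)⁻¹).toMonoidHom
        (r * (f.toFun (k⁻¹ * q.out) 1)⁻¹), ?_⟩
      ext1
      rw [Units.val_mul, coe_monoUnit, coe_monoUnit, coe_monoUnit, mono_mul_mono]
      simp [mul_smul]
    rw [hr', conj_mul_monoUnit hθ hc _ H.one_mem]

/-- `c` acts on a conjugate of the identity through the conjugates of `c`. -/
theorem monoUnit_smul_coeffHom_smul_inv_smul (g : G) (x : X) :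
    (monoUnit f g 1 : CrossedProduct f) • coeffHom f c • ((monoUnit f g 1)⁻¹ • x) =
      coeffHom f (g • c) • x := by
  rw [smul_smul, coe_monoUnit_one, U_mul_coeffHom, mul_smul, ← coe_monoUnit_one, ← Units.smul_def,
    smul_inv_smul]

variable (f) in
-- Linearity of `q` lets it cancel `θ` inside each conjugate, leaving the conjugate of `c`. A trace
-- of one gives Maschke's splitting; a nonzero trace gives a section up to a scalar, which serves
-- over `S`.
theorem exists_average_of_section [Fintype (G ⧸ H)]
    (hθ : ∀ h ∈ H, ∀ (s : K) x, θ (mono f h s • x) = mono f h s • θ x)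
    (hc : ∀ h ∈ H, h • c = c) (q : Y →ₗ[CrossedProduct f] X) (hq : ∀ x, q (θ x) = x) :
    ∃ θ' : X →ₗ[CrossedProduct f] Y, ∀ x,
      q (θ' x) = coeffHom f (∑ i : G ⧸ H, i.out • c) • x := by
  obtain ⟨θ', h⟩ := exists_average f hθ hc
  refine ⟨θ', fun x => ?_⟩
  simp only [h, conj, map_sum, map_smul, hq, monoUnit_smul_coeffHom_smul_inv_smul, Finset.sum_smul]

end Average

/-- Generalized Maschke theorem. -/
theorem isSemisimpleRing_of_res {K G : Type*} [CommRing K] [Group G] [MulSemiringAction G K]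
    (f : TwoCocycle G K) (H : Subgroup G) [Fintype (G ⧸ H)] (c : K) (hc : ∀ h ∈ H, h • c = c)
    (hc1 : ∑ i : G ⧸ H, i.out • c = 1) [IsSemisimpleRing (CrossedProduct (f.res H))] :
    IsSemisimpleRing (CrossedProduct f) := by
  let T := CrossedProduct f
  refine (isSemisimpleModule_iff _ _).2 ⟨fun N => ?_⟩
  let _ : Module (CrossedProduct (f.res H)) T := Module.compHom _ (inclHom f H)
  let _ : Module (CrossedProduct (f.res H)) (T ⧸ N) := Module.compHom _ (inclHom f H)
  let π : T →ₗ[CrossedProduct (f.res H)] T ⧸ N :=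
    { toFun := N.mkQ
      map_add' := map_add _
      map_smul' := fun a x => N.mkQ.map_smul (inclHom f H a) x }
  obtain ⟨θ, hθ⟩ := IsSemisimpleModule.lifting_property π N.mkQ_surjective
    (LinearMap.id : (T ⧸ N) →ₗ[CrossedProduct (f.res H)] T ⧸ N)
  have hlin : ∀ h ∈ H, ∀ (s : K) (x : T ⧸ N),
      θ.toAddMonoidHom (mono f h s • x) = mono f h s • θ.toAddMonoidHom x := fun h hh s x => by
    rw [← inclHom_mono f H ⟨h, hh⟩ s]
    exact θ.map_smul (mono (f.res H) ⟨h, hh⟩ s) x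
  obtain ⟨θ', hθ'⟩ := exists_average_of_section f hlin hc N.mkQ
    (fun x => LinearMap.congr_fun hθ x)
  simp only [hc1, map_one, one_smul] at hθ'
  refine ⟨LinearMap.range θ', ?_⟩
  constructor
  · rw [disjoint_iff, eq_bot_iff]
    rintro _ ⟨hx, y, rfl⟩
    have : N.mkQ (θ' y) = 0 := (Submodule.Quotient.mk_eq_zero N).2 hx
    rw [hθ'] at this
    simp [this]
  · rw [codisjoint_iff, eq_top_iff]
    intro x _
    refine Submodule.mem_sup.2 ⟨x - θ' (N.mkQ x), ?_, θ' (N.mkQ x), ⟨_, rfl⟩, by abel⟩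
    refine (Submodule.Quotient.mk_eq_zero N).1 ?_
    change N.mkQ (x - θ' (N.mkQ x)) = 0
    rw [map_sub, hθ', sub_self]

end CrossedProduct

/-! ### Submodules of projective modules when `T / Tπ` is semisimple -/

section Lifting

variable {T A : Type*} [Ring T] [Ring A] (τ : T →+* A) (π : T)

/-- If `T / T π` is semisimple for a regular element `π`, then every submodule `E` of a projective
module `V` with `π V ⊆ E` is projective. -/
theorem projective_of_smul_le [IsSemisimpleRing A] (hτ : Function.Surjective τ)
    (hker : ∀ t, τ t = 0 ↔ ∃ u, t = u * π) (hreg : ∀ t, t * π = 0 → t = 0)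
    {V : Type*} [AddCommGroup V] [Module T V] [Module.Projective T V] (E : Submodule T V)
    (hE : ∀ x : V, π • x ∈ E) : Module.Projective T E := by
  classical
  let _ : Module T A := Module.compHom A τ
  have hsmul : ∀ (t : T) (a : A), t • a = τ t * a := fun _ _ => rfl
  let τ' : T →ₗ[T] A := { toFun := τ, map_add' := map_add τ, map_smul' := fun a b => map_mul τ a b }
  have hss : IsSemisimpleModule T A := by
    have : RingHomSurjective τ := ⟨hτ⟩
    let e : A →ₛₗ[τ] A := { AddMonoidHom.id A with map_smul' := fun _ _ => rfl }
    exact (e.isSemisimpleModule_iff_of_bijective Function.bijective_id).2 inferInstance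
  -- As `π V ⊆ E`, the module `Q` is a quotient of a sum of copies of `A = T / Tπ`, and this
  -- quotient splits by semisimplicity. Lifting the section and the quotient map to `α : V → T^(Q)`
  -- and `β : T^(Q) → V` gives `β ∘ α ≡ id` modulo `E`.
  let Q := V ⧸ E
  let bv : Q → A →ₗ[T] Q := fun v =>
    (LinearMap.ker τ').liftQ (LinearMap.toSpanSingleton T Q v) (fun t ht => by
      obtain ⟨u, rfl⟩ := (hker t).1 ht
      obtain ⟨x, rfl⟩ := E.mkQ_surjective v
      rw [LinearMap.mem_ker, LinearMap.toSpanSingleton_apply, mul_smul, ← map_smul, E.mkQ_apply,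
        (Submodule.Quotient.mk_eq_zero E).2 (hE x), smul_zero]) ∘ₗ
      (τ'.quotKerEquivOfSurjective hτ).symm.toLinearMap
  have hbv : ∀ v t, bv v (τ t) = t • v := fun v t => by
    have : (τ'.quotKerEquivOfSurjective hτ).symm (τ t) = Submodule.Quotient.mk t := by
      rw [LinearEquiv.symm_apply_eq]; rfl
    simp [bv, this]
  let b : (Q →₀ A) →ₗ[T] Q := Finsupp.lsum ℕ bv
  have hb : Function.Surjective b := fun v => ⟨Finsupp.single v (τ 1), by
    simp only [b, Finsupp.lsum_single, hbv, one_smul]⟩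
  obtain ⟨i, hi⟩ := IsSemisimpleModule.lifting_property b hb LinearMap.id
  let qX : (Q →₀ T) →ₗ[T] (Q →₀ A) := Finsupp.mapRange.linearMap τ'
  have hqX : Function.Surjective qX := Finsupp.mapRange_surjective _ (map_zero _) hτ
  obtain ⟨α, hα⟩ := Module.projective_lifting_property qX (i ∘ₗ E.mkQ) hqX
  obtain ⟨β, hβ⟩ := Module.projective_lifting_property E.mkQ (b ∘ₗ qX) E.mkQ_surjective
  have hαβ : ∀ x, E.mkQ (β (α x)) = E.mkQ x := fun x => by
    have h1 := LinearMap.congr_fun hβ (α x)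
    have h2 := LinearMap.congr_fun hα x
    have h3 := LinearMap.congr_fun hi (E.mkQ x)
    simp only [LinearMap.comp_apply, LinearMap.id_apply] at h1 h2 h3
    rw [h1, h2, h3]
  -- right multiplication by `π` on the free module
  let ρ : (Q →₀ T) →ₗ[T] (Q →₀ T) := Finsupp.mapRange.linearMap (LinearMap.toSpanSingleton T T π)
  have hρ : Function.Injective ρ := by
    refine Finsupp.mapRange_injective _ (map_zero _) ?_
    rw [injective_iff_map_eq_zero]
    exact hreg
  have hβρ : ∀ x, β (ρ x) ∈ E := fun x => by
    induction x using Finsupp.induction_linear with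
    | zero => simp
    | add x y hx hy => rw [map_add, map_add]; exact E.add_mem hx hy
    | single v t =>
      have : ρ (Finsupp.single v t) = t • π • Finsupp.single v 1 := by
        simp [ρ]
      rw [this, map_smul, map_smul]
      exact E.smul_mem _ (hE _)
  have hker' : ∀ x, qX x = 0 → x ∈ LinearMap.range ρ := fun x hx => by
    have h : ∀ v, ∃ u, x v = u * π := fun v => (hker _).1 (DFunLike.congr_fun hx v)
    choose u hu using h
    refine ⟨Finsupp.onFinset x.support (fun v => if x v = 0 then 0 else u v) (by
      intro v hv; rw [Finsupp.mem_support_iff]; aesop), ?_⟩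
    ext v
    by_cases hv : x v = 0
    · simp [ρ, hv]
    · simp [ρ, hv, (hu v).symm]
  let eρ := LinearEquiv.ofInjective ρ hρ
  have hαE : ∀ x : E, α x ∈ LinearMap.range ρ := fun x => by
    apply hker'
    have h2 := LinearMap.congr_fun hα (x : V)
    simp only [LinearMap.comp_apply] at h2
    rw [h2, E.mkQ_apply, (Submodule.Quotient.mk_eq_zero E).2 x.2, map_zero]
  -- On `E` the map `α` takes values in the image of `ρ`, and `β ∘ ρ` lands in `E`. Thus `id = β ∘ α
  -- + (id - β ∘ α)` factors through `T^(Q) × V` and makes `E` a direct summand of it.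
  let α' : E →ₗ[T] (Q →₀ T) :=
    eρ.symm.toLinearMap ∘ₗ (α ∘ₗ E.subtype).codRestrict (LinearMap.range ρ) hαE
  let β' : (Q →₀ T) →ₗ[T] E := (β ∘ₗ ρ).codRestrict E hβρ
  let γ : V →ₗ[T] E := (LinearMap.id - β ∘ₗ α).codRestrict E (fun x => by
    refine (Submodule.Quotient.mk_eq_zero E).1 ?_
    change E.mkQ (x - β (α x)) = 0
    rw [map_sub, hαβ, sub_self])
  refine Module.Projective.of_split (M := (Q →₀ T) × V) (α'.prod E.subtype) (β'.coprod γ) ?_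
  ext x
  have : ρ (α' x) = α x := congrArg Subtype.val (eρ.apply_symm_apply _)
  simp [β', γ, this]

/-- If `T / T π` is semisimple for a regular normal element `π`, then every submodule `E` of a
projective module `V` with `π ^ k V ⊆ E` is projective. -/
theorem projective_of_pow_smul_le [IsSemisimpleRing A] (hτ : Function.Surjective τ)
    (hker : ∀ t, τ t = 0 ↔ ∃ u, t = u * π) (hreg : ∀ t, t * π = 0 → t = 0)
    (hnorm : ∀ t, ∃ t', π * t = t' * π) (k : ℕ) 
    {V : Type*} [AddCommGroup V] [Module T V] [Module.Projective T V] (E : Submodule T V)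
    (hE : ∀ x : V, π ^ k • x ∈ E) : Module.Projective T E := by
  have hpow : ∀ (k : ℕ) t, ∃ t', π ^ k * t = t' * π ^ k := by
    intro k
    induction k with
    | zero => intro t; exact ⟨t, by simp⟩
    | succ k ih =>
      intro t
      obtain ⟨t', h⟩ := hnorm t
      obtain ⟨t'', h'⟩ := ih t'
      exact ⟨t'', by rw [pow_succ, mul_assoc, h, ← mul_assoc, h', mul_assoc]⟩
  induction k generalizing V with
  | zero =>
    have : E = ⊤ := eq_top_iff.2 fun x _ => by simpa using hE x
    subst this
    exact Module.Projective.of_equiv Submodule.topEquiv.symm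
  | succ k ih =>
    -- The intermediate module `E + T π V` is projective by the case of exponent one, and normality
    -- of `π` gives `π ^ k V' ⊆ E`.
    let V' : Submodule T V := E ⊔ Submodule.span T (Set.range fun x : V => π • x)
    have : Module.Projective T V' := projective_of_smul_le τ π hτ hker hreg V' fun x =>
      Submodule.mem_sup_right (Submodule.subset_span ⟨x, rfl⟩)
    have hle : E ≤ V' := le_sup_left
    have key : ∀ x ∈ V', π ^ k • x ∈ E := by
      intro x hx
      obtain ⟨y, hy, z, hz, rfl⟩ := Submodule.mem_sup.1 hx
      clear hx
      rw [smul_add]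
      refine E.add_mem (E.smul_mem _ hy) ?_
      induction hz using Submodule.span_induction with
      | mem z hz =>
        obtain ⟨v, rfl⟩ := hz
        rw [smul_smul, ← pow_succ]
        exact hE v
      | zero => simp
      | add a b _ _ ha hb => rw [smul_add]; exact E.add_mem ha hb
      | smul t a _ ha =>
        obtain ⟨t', h⟩ := hpow k t
        rw [smul_smul, h, mul_smul]
        exact E.smul_mem _ ha
    have := ih (E.comap V'.subtype) (fun x => key x x.2)
    exact Module.Projective.of_equiv (Submodule.comapSubtypeEquivOfLe hle)

end Lifting

/-! ### Traces and semisimplicity of the reduction -/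

theorem QuotientGroup.out_smul_of_fixed {G K : Type*} [Group G] [MulAction G K] {H : Subgroup G}
    {c : K} (hc : ∀ h ∈ H, h • c = c) (g : G) : (g : G ⧸ H).out • c = g • c := by
  obtain ⟨h, hh⟩ := QuotientGroup.mk_out_eq_mul H g
  rw [hh, mul_smul, hc h h.2]

/-- Nonvanishing of the trace, by independence of characters. -/
theorem exists_sum_out_smul_ne_zero {G K : Type*} [Group G] [CommRing K] [IsDomain K]
    [MulSemiringAction G K] (H : Subgroup G) [Fintype (G ⧸ H)]
    (hH : ∀ g : G, (∀ x : K, g • x = x) → g ∈ H) : ∃ c : K, ∑ q : G ⧸ H, q.out • c ≠ 0 := by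
  by_contra! h0
  let χ : G ⧸ H → (K →* K) := fun q => (MulSemiringAction.toRingHom G K q.out).toMonoidHom
  have hχ : Function.Injective χ := fun q q' h => by
    rw [← QuotientGroup.out_eq' q, ← QuotientGroup.out_eq' q', QuotientGroup.eq]
    refine hH _ fun x => ?_
    have : q.out • x = q'.out • x := DFunLike.congr_fun h x
    rw [mul_smul, ← this, inv_smul_smul]
  have hli := (linearIndependent_monoidHom K K).comp χ hχ
  rw [Fintype.linearIndependent_iff] at hli
  exact one_ne_zero (hli (fun _ => 1) (by
    ext x
    simpa [χ] using h0 x) ((1 : G) : G ⧸ H))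

/-- A trace is `G`-invariant, so a nonzero one can be divided out. -/
theorem exists_sum_out_smul_eq_one {G K : Type*} [Group G] [Field K]
    [MulSemiringAction G K] (H : Subgroup G) [Fintype (G ⧸ H)]
    (hH : ∀ g : G, (∀ x : K, g • x = x) ↔ g ∈ H) : ∃ c : K, ∑ q : G ⧸ H, q.out • c = 1 := by
  obtain ⟨c, hc⟩ := exists_sum_out_smul_ne_zero H (fun g => (hH g).1)
  set d := ∑ q : G ⧸ H, q.out • c
  have hfix : ∀ c : K, ∀ h ∈ H, h • c = c := fun c h hh => (hH h).2 hh c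
  have hd : ∀ g : G, g • d = d := fun g => by
    rw [Finset.smul_sum]
    refine Fintype.sum_equiv (MulAction.toPerm g) _ _ fun q => ?_
    rw [MulAction.toPerm_apply]
    have hq : g • q = ((g * q.out : G) : G ⧸ H) := by
      conv_lhs => rw [← QuotientGroup.out_eq' q]
      rfl
    rw [hq, QuotientGroup.out_smul_of_fixed (hfix c), mul_smul]
  refine ⟨c * d⁻¹, ?_⟩
  simp only [smul_mul', smul_inv₀', hd]
  rw [← Finset.sum_mul, mul_inv_cancel₀ hc]

theorem mem_inertiaGroup_iff {S G : Type*} [CommRing S] [IsLocalRing S] [Group G]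
    [MulSemiringAction G S] (g : G) :
    g ∈ inertiaGroup S G ↔ ∀ x : IsLocalRing.ResidueField S, g • x = x := by
  rw [inertiaGroup, MonoidHom.mem_ker, RingEquiv.ext_iff]; rfl

namespace CrossedProduct

theorem eq_zero_of_mul_coeffHom {K G : Type*} [CommRing K] [IsDomain K] [Group G] [MulSemiringAction G K]
    (f : TwoCocycle G K) {r : K} (hr : r ≠ 0) (t : CrossedProduct f)
    (h : t * coeffHom f r = 0) : t = 0 := by
  ext g
  have := congrArg (coeff f g) h
  rw [coeff_mul_coeffHom, map_zero] at this
  simpa [hr, smul_eq_zero_iff_eq] using this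

theorem eq_zero_of_coeffHom_mul {K G : Type*} [CommRing K] [IsDomain K] [Group G] [MulSemiringAction G K]
    (f : TwoCocycle G K) {r : K} (hr : r ≠ 0) (t : CrossedProduct f)
    (h : coeffHom f r * t = 0) : t = 0 := by
  ext g
  have := congrArg (coeff f g) h
  rw [coeff_coeffHom_mul, map_zero] at this
  simpa [hr] using this

section LocalRing

variable {S G : Type*} [CommRing S] [IsLocalRing S] [Group G] [MulSemiringAction G S]
  (f : TwoCocycle G S)

/-- No condition on the index of `G_I` is needed: the averaging element is one of trace one,
available because only `G_I` acts trivially on the residue field. -/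
theorem isSemisimpleRing_residue [Finite G] (h : IsSemisimpleRing (InertiaAlgebra f)) :
    IsSemisimpleRing (CrossedProduct f.residue) := by
  have := Fintype.ofFinite (G ⧸ inertiaGroup S G)
  obtain ⟨c, hc⟩ := exists_sum_out_smul_eq_one (K := IsLocalRing.ResidueField S)
    (inertiaGroup S G) (fun g => (mem_inertiaGroup_iff g).symm)
  exact isSemisimpleRing_of_res _ _ c (fun h hh => (mem_inertiaGroup_iff h).1 hh c) hc

theorem isSemisimpleRing_op [Finite G] (h : IsSemisimpleRing (CrossedProduct f.residue)) :
    IsSemisimpleRing (CrossedProduct f.op.residue) :=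
  (opEquiv f.residue).symm.isSemisimpleRing

theorem coeff_reduction (a : CrossedProduct f) (g : G) :
    coeff f.residue g (reduction f a) = IsLocalRing.residue S (coeff f g a) :=
  coeff_mapHom ..

theorem reduction_mono (g : G) (s : S) :
    reduction f (mono f g s) = mono f.residue g (IsLocalRing.residue S s) := mapHom_mono ..

theorem reduction_surjective [Finite G] : Function.Surjective (reduction f) :=
  mapHom_surjective _ _ _ _ _ IsLocalRing.residue_surjective

end LocalRing

/-! ### Semisimple reduction implies heredity -/

section DVR

variable {S G : Type*} [CommRing S] [IsDomain S] [IsDiscreteValuationRing S] [Group G]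
  [MulSemiringAction G S] (f : TwoCocycle G S)

theorem _root_.Irreducible.exists_eq_mul_smul {π : S} (hπ : Irreducible π) (g : G) :
    ∃ w : Sˣ, π = w * g • π := by
  have : Irreducible (g • π) :=
    (MulEquiv.irreducible_iff (MulSemiringAction.toRingEquiv G S g)).2 hπ
  obtain ⟨w, hw⟩ := IsDiscreteValuationRing.associated_of_irreducible S this hπ
  exact ⟨w, by rw [mul_comm, hw]⟩

/-- An automorphism preserves the valuation, so `π U_g` and `U_g π` differ by the unit `π / gπ`: the
element `π` is normal. -/
theorem exists_coeffHom_mul_eq {π : S} (hπ : Irreducible π) (t : CrossedProduct f) :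
    ∃ t', coeffHom f π * t = t' * coeffHom f π := by
  induction t using CrossedProduct.induction with
  | h0 => exact ⟨0, by simp⟩
  | hadd x y hx hy =>
    obtain ⟨x', hx⟩ := hx
    obtain ⟨y', hy⟩ := hy
    exact ⟨x' + y', by rw [mul_add, hx, hy, add_mul]⟩
  | hm g s =>
    obtain ⟨w, hw⟩ := hπ.exists_eq_mul_smul g
    refine ⟨mono f g (s * w), ?_⟩
    rw [mono_mul_coeffHom, coeffHom_mul_mono, mul_assoc, ← hw, mul_comm]

/-- Since `gπ` and `π` are associates, divisibility of all coefficients by `π` is the same as being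
a left multiple of `π`. This identifies `S̄^f̄ G` with `T / Tπ`. -/
theorem reduction_eq_zero_iff [Finite G] {π : S} (hπ : Irreducible π) (t : CrossedProduct f) :
    reduction f t = 0 ↔ ∃ u, t = u * coeffHom f π := by
  constructor
  · intro h
    cases nonempty_fintype G
    have h' : ∀ g, ∃ s, mono f g (coeff f g t) = mono f g s * coeffHom f π := fun g => by
      have h1 : IsLocalRing.residue S (coeff f g t) = 0 := by
        rw [← coeff_reduction, h, map_zero]
      rw [IsLocalRing.residue_eq_zero_iff, hπ.maximalIdeal_eq, Ideal.mem_span_singleton] at h1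
      obtain ⟨a, ha⟩ := h1
      obtain ⟨w, hw⟩ := hπ.exists_eq_mul_smul g
      refine ⟨a * w, ?_⟩
      rw [mono_mul_coeffHom, ha, mul_assoc, ← hw, mul_comm]
    choose s hs using h'
    refine ⟨∑ g, mono f g (s g), ?_⟩
    rw [Finset.sum_mul, ← Finset.sum_congr rfl fun g _ => hs g, sum_mono_coeff]
  · rintro ⟨u, rfl⟩
    ext g
    rw [coeff_reduction, coeff_mul_coeffHom, map_mul, map_zero]
    refine mul_eq_zero_of_right _ ?_
    rw [IsLocalRing.ResidueField.residue_smul,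
      (IsLocalRing.residue_eq_zero_iff π).2 hπ.not_isUnit, smul_zero]

/-- The left module structure of a crossed product over its coefficients. -/
abbrev leftModule {K G : Type*} [CommRing K] [Group G] [MulSemiringAction G K]
    (f : TwoCocycle G K) : Module K (CrossedProduct f) := Module.compHom _ (coeffHom f)

attribute [local instance] leftModule

/-- The coordinates with respect to the basis `U_g`. -/
def coordEquiv {K G : Type*} [CommRing K] [Group G] [MulSemiringAction G K]
    (f : TwoCocycle G K) : CrossedProduct f ≃ₗ[K] (G →₀ K) where
  toFun a := a
  invFun a := a
  left_inv _ := rfl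
  right_inv _ := rfl
  map_add' _ _ := rfl
  map_smul' s a := Finsupp.ext fun g => coeff_coeffHom_mul f s a g

theorem projective_of_isSemisimpleRing_residue [Finite G] [FaithfulSMul G S]
    (h : IsSemisimpleRing (CrossedProduct f.residue))
    (I : Submodule (CrossedProduct f) (CrossedProduct f)) :
    Module.Projective (CrossedProduct f) I := by
  classical
  obtain ⟨π, hπ⟩ := IsDiscreteValuationRing.exists_irreducible S
  have : Module.Free S (CrossedProduct f) := Module.Free.of_equiv (coordEquiv f).symm
  have : Module.Finite S (CrossedProduct f) := Module.Finite.equiv (coordEquiv f).symm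
  let IS : Submodule S (CrossedProduct f) :=
    { I with smul_mem' := fun s x hx => I.smul_mem (coeffHom f s) hx }
  let b := Module.Free.chooseBasis S IS
  let ι := Module.Free.ChooseBasisIndex S IS
  let θ : I →+ (ι →₀ CrossedProduct f) :=
    (Finsupp.mapRange.addMonoidHom (coeffHom f).toAddMonoidHom).comp
      (b.repr.toLinearMap.toAddMonoidHom)
  let q : (ι →₀ CrossedProduct f) →ₗ[CrossedProduct f] I :=
    Finsupp.linearCombination _ (fun i => (b i : I))
  have hθ : ∀ (s : S) x, θ (coeffHom f s • x) = coeffHom f s • θ x := fun s x => by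
    let x' : IS := ⟨x.1, x.2⟩
    have h1 : b.repr (s • x') = s • b.repr x' := map_smul b.repr s x'
    ext i : 1
    change coeffHom f (b.repr (s • x') i) = coeffHom f s * coeffHom f (b.repr x' i)
    rw [h1, Finsupp.smul_apply, smul_eq_mul, map_mul]
  have hq : ∀ x, q (θ x) = x := fun x => by
    have := b.linearCombination_repr (⟨x.1, x.2⟩ : IS)
    refine Eq.trans ?_ this
    rw [Finsupp.linearCombination_apply]
    change Finsupp.linearCombination _ _ (Finsupp.mapRange (coeffHom f) (map_zero _) (b.repr x)) = _
    rw [Finsupp.linearCombination_apply, Finsupp.sum_mapRange_index (by simp)]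
    rfl
  have hθ1 : ∀ h ∈ (⊥ : Subgroup G), ∀ (s : S) x, θ (mono f h s • x) = mono f h s • θ x := by
    intro h hh s x
    rw [Subgroup.mem_bot.1 hh, show mono f 1 s = coeffHom f (s * f.toFun 1 1) by
      rw [coeffHom_apply, mul_assoc, Units.mul_inv, mul_one], hθ]
  have := Fintype.ofFinite (G ⧸ (⊥ : Subgroup G))
  obtain ⟨c, hc⟩ := exists_sum_out_smul_ne_zero (K := S) (⊥ : Subgroup G) (fun g hg =>
    Subgroup.mem_bot.2 (FaithfulSMul.eq_of_smul_eq_smul (α := S) fun x => by rw [hg, one_smul]))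
  obtain ⟨θ', hθ'⟩ := exists_average_of_section f hθ1
    (fun h hh => by rw [Subgroup.mem_bot.1 hh, one_smul] : ∀ h ∈ (⊥ : Subgroup G), h • c = c) q hq
  set r := ∑ i : G ⧸ (⊥ : Subgroup G), i.out • c
  obtain ⟨k, u, hu⟩ := IsDiscreteValuationRing.eq_unit_mul_pow_irreducible hc hπ
  -- Since `q ∘ θ'` is multiplication by `r ≠ 0`, this map is injective, and `r v = θ' (q v) + (r v
  -- - θ' (q v))` puts `r` times the free module in its image. As `r` is a unit times `π ^ k`, the
  -- lifting criterion applies to the image.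
  let j : (I × LinearMap.ker q) →ₗ[CrossedProduct f] (ι →₀ CrossedProduct f) :=
    θ'.coprod (LinearMap.ker q).subtype
  have hj : Function.Injective j := by
    rw [injective_iff_map_eq_zero]
    rintro ⟨x, y⟩ hxy
    have hxy' : θ' x + y = 0 := by simpa [j] using hxy
    have hx : x = 0 := by
      have := congrArg q hxy'
      rw [map_add, LinearMap.mem_ker.1 y.2, hθ', add_zero, map_zero] at this
      exact Subtype.ext (eq_zero_of_coeffHom_mul f hc _ (congrArg Subtype.val this))
    subst hx
    rw [map_zero, zero_add] at hxy'
    exact Prod.ext rfl (Subtype.ext hxy')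
  have hr : ∀ v, coeffHom f r • v ∈ LinearMap.range j := fun v => by
    refine ⟨(q v, ⟨coeffHom f r • v - θ' (q v), ?_⟩), ?_⟩
    · rw [LinearMap.mem_ker, map_sub, map_smul, hθ', sub_self]
    · simp [j]
  have : Module.Projective (CrossedProduct f) (LinearMap.range j) := by
    refine projective_of_pow_smul_le (reduction f) (coeffHom f π) (reduction_surjective f)
      (reduction_eq_zero_iff f hπ) (eq_zero_of_mul_coeffHom f hπ.ne_zero)
      (exists_coeffHom_mul_eq f hπ) k _ fun v => ?_
    have : coeffHom f π ^ k = coeffHom f (u⁻¹ : Sˣ) * coeffHom f r := by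
      rw [← map_pow, ← map_mul, hu, Units.inv_mul_cancel_left]
    rw [this, mul_smul]
    exact Submodule.smul_mem _ _ (hr v)
  have : Module.Projective (CrossedProduct f) (I × LinearMap.ker q) :=
    Module.Projective.of_equiv (LinearEquiv.ofInjective j hj).symm
  exact Module.Projective.of_split (LinearMap.inl (CrossedProduct f) I (LinearMap.ker q))
    (LinearMap.fst (CrossedProduct f) I (LinearMap.ker q)) (by ext; simp)

/-- If the inertia algebra is semisimple, then the crossed product is hereditary. -/
theorem isHereditaryRing_of_isSemisimpleRing [Finite G] [FaithfulSMul G S]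
    (h : IsSemisimpleRing (InertiaAlgebra f)) : IsHereditaryRing (CrossedProduct f) := by
  have hA := isSemisimpleRing_residue f h
  refine ⟨projective_of_isSemisimpleRing_residue f hA, fun I => ?_⟩
  -- Right ideals become left ideals of the crossed product for the opposite cocycle, whose
  -- reduction is again semisimple.
  let e := opEquiv f
  let I' : Submodule (CrossedProduct f.op) (CrossedProduct f.op) :=
    { carrier := {a | (e a).unop ∈ I}
      add_mem' := fun {a b} ha hb => by
        simp only [Set.mem_ofPred_eq, map_add, MulOpposite.unop_add] at *
        exact I.add_mem ha hb
      zero_mem' := by simp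
      smul_mem' := fun c x hx => by
        simp only [Set.mem_ofPred_eq, smul_eq_mul, map_mul, MulOpposite.unop_mul] at *
        exact I.smul_mem (e c) hx }
  have := projective_of_isSemisimpleRing_residue f.op (isSemisimpleRing_op f hA) I'
  have h1 : ∀ a : I', (e a).unop ∈ I := fun a => a.2
  have h2 : ∀ a : I, e.symm (.op a) ∈ I' := fun a => by
    change (e (e.symm (.op a.1))).unop ∈ I
    simp
  let _ := RingHomInvPair.of_ringEquiv e
  let _ := RingHomInvPair.of_ringEquiv e.symm
  let e₂ : I' ≃ₛₗ[(e : CrossedProduct f.op →+* (CrossedProduct f)ᵐᵒᵖ)] I :=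
    { toFun := fun a => ⟨(e a).unop, h1 a⟩
      invFun := fun a => ⟨e.symm (.op a), h2 a⟩
      left_inv := fun a => by simp
      right_inv := fun a => by simp
      map_add' := fun a b => by ext1; simp
      map_smul' := fun c a => by
        ext1
        simp }
  exact Module.Projective.of_equiv e₂

end DVR

end CrossedProduct

/-! ### Descent of heredity to subgroups -/

namespace CrossedProduct

variable {K G : Type*} [CommRing K] [Group G] [MulSemiringAction G K] (f : TwoCocycle G K)

theorem coeff_mono_mul (h k : G) (s : K) (a : CrossedProduct f) :
    coeff f k (mono f h s * a) = s * h • coeff f (h⁻¹ * k) a * f.toFun h (h⁻¹ * k) := by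
  classical
  induction a using CrossedProduct.induction with
  | h0 => simp
  | hadd x y hx hy => rw [mul_add, map_add, hx, hy, map_add, smul_add]; ring
  | hm g t =>
    rw [mono_mul_mono, coeff_mono, coeff_mono]
    by_cases H : h * g = k
    · subst H; simp
    · have : g ≠ h⁻¹ * k := fun h' => H (by rw [h', mul_inv_cancel_left])
      simp [H, this]

theorem coeff_mul_mono (h k : G) (t : K) (a : CrossedProduct f) :
    coeff f k (a * mono f h t) = coeff f (k * h⁻¹) a * (k * h⁻¹) • t * f.toFun (k * h⁻¹) h := by
  classical
  induction a using CrossedProduct.induction with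
  | h0 => simp
  | hadd x y hx hy => rw [add_mul, map_add, hx, hy, map_add]; ring
  | hm g s =>
    rw [mono_mul_mono, coeff_mono, coeff_mono]
    by_cases H : g * h = k
    · subst H; simp
    · have : g ≠ k * h⁻¹ := fun h' => H (by rw [h', inv_mul_cancel_right])
      simp [H, this]

section Restriction

variable (H : Subgroup G)

/-- The projection of a crossed product onto the sub-crossed product graded by a subgroup. -/
def resAddHom : CrossedProduct f →+ CrossedProduct (f.res H) :=
  Finsupp.comapDomain.addMonoidHom (M := K) (f := (Subtype.val : H → G)) Subtype.val_injective

theorem coeff_resAddHom (a : CrossedProduct f) (h : H) :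
    coeff (f.res H) h (resAddHom f H a) = coeff f h a := rfl

theorem coeff_inclHom (a : CrossedProduct (f.res H)) (h : H) :
    coeff f h (inclHom f H a) = coeff (f.res H) h a :=
  Finsupp.mapDomain_apply Subtype.val_injective _ _

theorem resAddHom_inclHom (a : CrossedProduct (f.res H)) : resAddHom f H (inclHom f H a) = a := by
  ext h
  rw [coeff_resAddHom, coeff_inclHom]

/-- With the mirror statement below, the sub-crossed product is a direct summand of the whole ring
as a bimodule over itself; this is what lets heredity descend. -/
theorem resAddHom_inclHom_mul (b : CrossedProduct (f.res H)) (a : CrossedProduct f) :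
    resAddHom f H (inclHom f H b * a) = b * resAddHom f H a := by
  induction b using CrossedProduct.induction with
  | h0 => simp
  | hadd x y hx hy => rw [map_add, add_mul, map_add, hx, hy, add_mul]
  | hm h s =>
    ext k
    rw [coeff_resAddHom, inclHom_mono, coeff_mono_mul, coeff_mono_mul, coeff_resAddHom]
    rfl

theorem resAddHom_mul_inclHom (b : CrossedProduct (f.res H)) (a : CrossedProduct f) :
    resAddHom f H (a * inclHom f H b) = resAddHom f H a * b := by
  induction b using CrossedProduct.induction with
  | h0 => simp
  | hadd x y hx hy => rw [map_add, mul_add, map_add, hx, hy, mul_add]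
  | hm h s =>
    ext k
    rw [coeff_resAddHom, inclHom_mono, coeff_mul_mono, coeff_mul_mono, coeff_resAddHom]
    rfl

/-- Left heredity passes from a crossed product to the sub-crossed product of a subgroup. -/
theorem projective_res
    (hT : ∀ I : Submodule (CrossedProduct f) (CrossedProduct f),
      Module.Projective (CrossedProduct f) I)
    (I : Submodule (CrossedProduct (f.res H)) (CrossedProduct (f.res H))) :
    Module.Projective (CrossedProduct (f.res H)) I := by
  let I' : Submodule (CrossedProduct f) (CrossedProduct f) :=
    Submodule.span _ (Set.range fun x : I => inclHom f H x)
  have hmem : ∀ x : I, inclHom f H x ∈ I' := fun x => Submodule.subset_span ⟨x, rfl⟩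
  let q : (I →₀ CrossedProduct f) →ₗ[CrossedProduct f] I' :=
    Finsupp.linearCombination _ (fun x : I => (⟨inclHom f H x, hmem x⟩ : I'))
  have hq : Function.Surjective q := by
    rintro ⟨y, hy⟩
    obtain ⟨c, hc⟩ := (Finsupp.mem_span_range_iff_exists_finsupp).1 hy
    refine ⟨c, Subtype.ext ?_⟩
    refine Eq.trans ?_ hc
    rw [Finsupp.linearCombination_apply, Finsupp.sum, Finsupp.sum]
    simp
  have := hT I'
  obtain ⟨s, hs⟩ := Module.projective_lifting_property q LinearMap.id hq
  -- The cover of the extended ideal by a free module splits; projecting the coefficients of that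
  -- splitting to `H` splits the cover of `I`.
  let r : I →ₗ[CrossedProduct (f.res H)] (I →₀ CrossedProduct (f.res H)) :=
    { toFun := fun x => Finsupp.mapRange (resAddHom f H) (map_zero _) (s ⟨_, hmem x⟩)
      map_add' := fun x y => by
        rw [← Finsupp.mapRange_add (map_add _), ← map_add]
        congr 2
        ext1
        simp
      map_smul' := fun b x => by
        have : (⟨_, hmem (b • x)⟩ : I') = inclHom f H b • ⟨_, hmem x⟩ := by
          ext1
          simp
        rw [this, map_smul]
        ext i : 1
        simp [resAddHom_inclHom_mul] }
  refine Module.Projective.of_split r (Finsupp.linearCombination _ id) ?_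
  refine LinearMap.ext fun x => Subtype.ext ?_
  have h1 := congrArg Subtype.val (LinearMap.congr_fun hs ⟨_, hmem x⟩)
  have h2 := congrArg (resAddHom f H) h1
  simp only [LinearMap.comp_apply, LinearMap.id_apply, resAddHom_inclHom] at h2 ⊢
  refine Eq.trans ?_ h2
  simp only [q, r, LinearMap.coe_mk, AddHom.coe_mk, Finsupp.linearCombination_apply]
  rw [Finsupp.sum_mapRange_index (by simp), Finsupp.sum, Finsupp.sum]
  simp [resAddHom_mul_inclHom]

end Restriction

/-! ### The determinantal norm -/

section Norm

variable [Fintype G]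

/-- The matrix of right multiplication by `x` with respect to the basis `U_g`. -/
def rightMulMatrix (x : CrossedProduct f) : Matrix G G K := fun g h => coeff f h (U f g * x)

theorem coeff_mul (b x : CrossedProduct f) (h : G) :
    coeff f h (b * x) = Matrix.vecMul (fun g => coeff f g b) (rightMulMatrix f x) h := by
  conv_lhs => rw [← sum_mono_coeff f b, Finset.sum_mul, map_sum]
  refine Finset.sum_congr rfl fun g _ => ?_
  rw [mono_eq, mul_assoc, coeff_coeffHom_mul]
  rfl

theorem rightMulMatrix_mul (x y : CrossedProduct f) :
    rightMulMatrix f (x * y) = rightMulMatrix f x * rightMulMatrix f y := by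
  ext g h
  rw [rightMulMatrix, ← mul_assoc, coeff_mul]
  rfl

variable [DecidableEq G]

/-- The reduced norm: the determinant of right multiplication over the coefficient ring. -/
def norm (x : CrossedProduct f) : K := (rightMulMatrix f x).det

theorem norm_mul (x y : CrossedProduct f) : norm f (x * y) = norm f x * norm f y := by
  rw [norm, rightMulMatrix_mul, Matrix.det_mul, norm, norm]

theorem norm_coeffHom (s : K) : norm f (coeffHom f s) = ∏ g : G, g • s := by
  have : rightMulMatrix f (coeffHom f s) = Matrix.diagonal fun g => g • s := by
    ext g h
    rw [rightMulMatrix, U, mono_mul_coeffHom, one_mul, coeff_mono, Matrix.diagonal_apply]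
  rw [norm, this, Matrix.det_diagonal]

/-- Left multiplication by `U_g` is `g`-semilinear, commutes with right multiplication by `x`, and
permutes the basis up to cocycle values. Those values form the same diagonal matrix on both sides
and cancel in the determinant. -/
theorem smul_norm (g : G) (x : CrossedProduct f) : g • norm f x = norm f x := by
  have key : ∀ h k, g • rightMulMatrix f x h k * f.toFun g k =
      f.toFun g h * rightMulMatrix f x (g * h) (g * k) := fun h k => by
    have h1 : U f g * (U f h * x) = coeffHom f (f.toFun g h) * (U f (g * h) * x) := by
      rw [← mul_assoc, U_mul_U, mul_assoc]
    have h2 := congrArg (coeff f (g * k)) h1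
    rw [coeff_coeffHom_mul, U, coeff_mono_mul, one_mul, inv_mul_cancel_left] at h2
    exact h2
  have e1 : (Matrix.diagonal fun h => (f.toFun g h : K)) *
      (rightMulMatrix f x).submatrix (Equiv.mulLeft g) (Equiv.mulLeft g) =
      (rightMulMatrix f x).map (MulSemiringAction.toRingHom G K g) *
        Matrix.diagonal fun h => (f.toFun g h : K) := by
    ext h k
    rw [Matrix.diagonal_mul, Matrix.mul_diagonal]
    exact (key h k).symm
  have e2 := congrArg Matrix.det e1
  rw [Matrix.det_mul, Matrix.det_mul, Matrix.det_submatrix_equiv_self, mul_comm,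
    Matrix.det_diagonal] at e2
  have hu : IsUnit (∏ h, (f.toFun g h : K)) := by
    rw [← Units.coe_prod]
    exact Units.isUnit _
  have := hu.mul_right_cancel e2
  rw [← RingHom.mapMatrix_apply, ← RingHom.map_det] at this
  exact this.symm

/-- Cramer's rule: apply the adjugate to the coordinates of `z`. -/
theorem exists_mul_eq_norm_mul (x z : CrossedProduct f) :
    ∃ b, b * x = coeffHom f (norm f x) * z := by
  let v := Matrix.vecMul (fun g => coeff f g z) (rightMulMatrix f x).adjugate
  refine ⟨∑ g, mono f g (v g), ?_⟩
  have hv : (fun g => coeff f g (∑ g, mono f g (v g))) = v := by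
    ext g
    simp [map_sum, coeff_mono]
  ext h
  rw [coeff_mul, hv, Matrix.vecMul_vecMul, Matrix.adjugate_mul, coeff_coeffHom_mul,
    Matrix.vecMul_smul, Matrix.vecMul_one]
  rfl

theorem exists_mul_eq_one_of_isUnit_norm {x : CrossedProduct f} (h : IsUnit (norm f x)) :
    ∃ b, b * x = 1 := by
  obtain ⟨u, hu⟩ := h
  obtain ⟨b, hb⟩ := exists_mul_eq_norm_mul f x (coeffHom f (u⁻¹ : Kˣ))
  exact ⟨b, by rw [hb, ← hu, ← map_mul, Units.mul_inv, map_one]⟩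

theorem norm_ne_zero [IsDomain K] {x : CrossedProduct f} (h : ∀ b, b * x = 0 → b = 0) :
    norm f x ≠ 0 := by
  intro h0
  obtain ⟨v, hv, hv0⟩ := Matrix.exists_vecMul_eq_zero_iff.2 h0
  refine hv ?_
  have hc : (fun g => coeff f g (∑ g, mono f g (v g))) = v := by
    ext g
    simp [map_sum, coeff_mono]
  have := h (∑ g, mono f g (v g)) (by ext k; rw [coeff_mul, hc, hv0]; simp)
  rw [← hc, this]
  ext; simp

end Norm

theorem norm_reduction {S : Type*} [CommRing S] [IsLocalRing S] [MulSemiringAction G S]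
    [Fintype G] [DecidableEq G] (f : TwoCocycle G S) (x : CrossedProduct f) :
    norm f.residue (reduction f x) = IsLocalRing.residue S (norm f x) := by
  rw [norm, norm, RingHom.map_det]
  congr 1
  ext g h
  rw [RingHom.mapMatrix_apply, Matrix.map_apply, rightMulMatrix, rightMulMatrix, ← coeff_reduction,
    map_mul (reduction f), U, U, reduction_mono, map_one (IsLocalRing.residue S)]

end CrossedProduct

/-! ### Representations of `p`-groups in characteristic `p` -/

theorem IsPGroup.subsingleton_of_one {P : Type*} [Group P] (hP : IsPGroup 1 P) :
    Subsingleton P :=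
  ⟨fun a b => by
    obtain ⟨k, hk⟩ := hP a
    obtain ⟨l, hl⟩ := hP b
    rw [one_pow, pow_one] at hk hl
    rw [hk, hl]⟩

theorem IsPGroup.exists_card_eq_pow {p : ℕ} (k : Type*) [Field k] [ExpChar k p] {P : Type*}
    [Group P] [Finite P] (hP : IsPGroup p P) : ∃ m, Nat.card P = p ^ m := by
  rcases ‹ExpChar k p› with _ | hp
  · have := hP.subsingleton_of_one
    exact ⟨0, by simp⟩
  · have := Fact.mk hp
    exact IsPGroup.iff_card.1 hP

/-- A nonzero submodule of a representation of a `p`-group in characteristic `p` contains a nonzero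
invariant. -/
theorem IsPGroup.exists_fixed_ne_zero {p : ℕ} (k : Type*) [Field k] [ExpChar k p] {P : Type*}
    [Group P] [Finite P] (hP : IsPGroup p P) {V : Type*} [AddCommGroup V] [Module k V]
    [DistribMulAction P V] (W : AddSubgroup V) (hW : ∀ (g : P), ∀ w ∈ W, g • w ∈ W) {w : V}
    (hw : w ∈ W) (hw0 : w ≠ 0) : ∃ v ∈ W, v ≠ 0 ∧ ∀ g : P, g • v = v := by
  rcases ‹ExpChar k p› with _ | hp
  · have := hP.subsingleton_of_one
    exact ⟨w, hw, hw0, fun g => by rw [Subsingleton.elim g 1, one_smul]⟩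
  · have := Fact.mk hp
    let _ : Module (ZMod p) V := Module.compHom V (ZMod.castHom dvd_rfl k)
    -- Over the prime field the span of the orbit is finite of order divisible by `p`. The fixed
    -- points are counted modulo `p`, and `0` is one, so there is another.
    let M : Submodule (ZMod p) V := Submodule.span (ZMod p) (Set.range fun g : P => g • w)
    have : Module.Finite (ZMod p) M := Module.Finite.span_of_finite _ (Set.finite_range _)
    have : Finite M := Module.finite_of_finite (ZMod p)
    have hsm : ∀ (g : P) (c : ZMod p) (x : V), g • c • x = c • g • x := fun g c x => by
      obtain ⟨n, rfl⟩ := ZMod.natCast_zmod_surjective c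
      rw [Nat.cast_smul_eq_nsmul, Nat.cast_smul_eq_nsmul]
      exact map_nsmul (DistribSMul.toAddMonoidHom V g) n x
    have hM : ∀ (g : P), ∀ x ∈ M, g • x ∈ M := fun g x hx => by
      induction hx using Submodule.span_induction with
      | mem x hx =>
        obtain ⟨h, rfl⟩ := hx
        exact Submodule.subset_span ⟨g * h, mul_smul g h w⟩
      | zero => simp
      | add x y _ _ hx hy => rw [smul_add]; exact M.add_mem hx hy
      | smul c x _ hx => rw [hsm]; exact M.smul_mem c hx
    have hMW : ∀ x ∈ M, x ∈ W := fun x hx => by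
      induction hx using Submodule.span_induction with
      | mem x hx =>
        obtain ⟨h, rfl⟩ := hx
        exact hW h w hw
      | zero => exact W.zero_mem
      | add x y _ _ hx hy => exact W.add_mem hx hy
      | smul c x _ hx =>
        obtain ⟨n, rfl⟩ := ZMod.natCast_zmod_surjective c
        rw [Nat.cast_smul_eq_nsmul]
        exact W.nsmul_mem hx n
    let _ : MulAction P M :=
      { smul := fun g x => ⟨g • x.1, hM g x x.2⟩
        one_smul := fun x => Subtype.ext (one_smul P x.1)
        mul_smul := fun g h x => Subtype.ext (mul_smul g h x.1) }
    have hwM : w ∈ M := Submodule.subset_span ⟨1, one_smul P w⟩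
    have hdvd : p ∣ Nat.card M := by
      have : Nontrivial M := ⟨⟨⟨w, hwM⟩, 0, fun h => hw0 (congrArg Subtype.val h)⟩⟩
      rw [Module.natCard_eq_pow_finrank (K := ZMod p), Nat.card_zmod]
      exact dvd_pow_self p Module.finrank_pos.ne'
    obtain ⟨v, hv, hv0⟩ := hP.exists_fixed_point_of_prime_dvd_card_of_fixed_point M hdvd (a := 0)
      (fun g => Subtype.ext (smul_zero g))
    exact ⟨v, hMW v v.2, fun h => hv0 (Subtype.ext h.symm), fun g => congrArg Subtype.val (hv g)⟩

/-- In the group algebra of a `p`-group in characteristic `p`, elements of nonzero augmentation are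
right regular. -/
theorem MonoidAlgebra.eq_zero_of_mul_eq_zero_of_isPGroup {p : ℕ} {k : Type*} [Field k]
    [ExpChar k p] {P : Type*} [Group P] [Finite P] (hP : IsPGroup p P) {a b : MonoidAlgebra k P}
    (ha : MonoidAlgebra.lift k k P 1 a ≠ 0) (hb : b * a = 0) : b = 0 := by
  by_contra hb0
  let _ : DistribMulAction P (MonoidAlgebra k P) :=
    DistribMulAction.compHom _ (MonoidAlgebra.of k P)
  have hsm : ∀ (g : P) (x : MonoidAlgebra k P), g • x = MonoidAlgebra.of k P g * x :=
    fun _ _ => rfl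
  -- The left annihilator of `a` is stable under left translation, so it contains a nonzero fixed
  -- `v`. Such a `v` has constant coefficients, and right multiplication scales it by the
  -- augmentation; hence `v * a ≠ 0`, a contradiction.
  let W : AddSubgroup (MonoidAlgebra k P) := (AddMonoidHom.mulRight a).ker
  obtain ⟨v, hv, hv0, hfix⟩ := hP.exists_fixed_ne_zero k W (fun g w hw => by
    have hw' : w * a = 0 := hw
    change g • w * a = 0
    rw [hsm, mul_assoc, hw', mul_zero]) (w := b) hb hb0
  have hconst : ∀ g, v.coeff g = v.coeff 1 := fun g => by
    have := congrArg (fun x : MonoidAlgebra k P => x.coeff g) (hfix g)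
    simp only [hsm, MonoidAlgebra.of_apply] at this
    rw [← this, MonoidAlgebra.coeff_single_mul_apply]
    simp
  have key : ∀ x : MonoidAlgebra k P, v * x = MonoidAlgebra.lift k k P 1 x • v := fun x => by
    induction x using MonoidAlgebra.induction_linear with
    | zero => simp
    | add x y hx hy => rw [mul_add, hx, hy, map_add, add_smul]
    | single g r =>
      ext h
      rw [MonoidAlgebra.coeff_mul_single_apply, hconst]
      simp [hconst h, mul_comm]
  have hva : v * a = 0 := hv
  rw [key] at hva
  exact (smul_eq_zero.1 hva).elim ha hv0

/-! ### Characters of twisted group algebras of `p`-groups -/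

namespace CrossedProduct

section Character

variable {k L P : Type*} [Field k] [Field L] [Algebra k L] [Group P]
  [MulSemiringAction P k] [ActsTrivially P k] (f : TwoCocycle P k)

/-- Over an algebraically closed field, a cocycle of a `p`-group in characteristic `p` is a
coboundary. -/
theorem _root_.TwoCocycle.exists_coboundary [Finite P] [IsAlgClosed L] {p : ℕ} [ExpChar L p] (hP : IsPGroup p P) :
    ∃ c : P → L, (∀ g h, c g * c h = algebraMap k L (f.toFun g h) * c (g * h)) ∧
      (∀ g, c g ≠ 0) ∧ ∀ g, c g ^ Nat.card P ∈ (algebraMap k L).range := by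
  cases nonempty_fintype P
  obtain ⟨m, hm⟩ := hP.exists_card_eq_pow L
  -- The product of the cocycle identities over the last argument shows that `f ^ |P|` is the
  -- coboundary of `N`. As `|P|` is a power of `p`, roots are unique and the `|P|`-th roots of `N`
  -- split `f` itself.
  let N : P → k := fun g => ∏ h, (f.toFun g h : k)
  have hN0 : ∀ g, N g ≠ 0 := fun g => Finset.prod_ne_zero_iff.2 fun h _ => Units.ne_zero _
  have hN : ∀ g h, N g * N h = (f.toFun g h : k) ^ Nat.card P * N (g * h) := fun g h => by
    have h1 : ∏ j, ((f.toFun (g * h) j : k) * (f.toFun g h : k)) =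
        ∏ j, ((f.toFun h j : k) * (f.toFun g (h * j) : k)) :=
      Finset.prod_congr rfl fun j _ => by
        have := f.cocycle g h j
        rwa [ActsTrivially.smul_eq] at this
    rw [Finset.prod_mul_distrib, Finset.prod_mul_distrib, Finset.prod_const, Finset.card_univ,
      Fintype.prod_equiv (Equiv.mulLeft h) (fun j => (f.toFun g (h * j) : k))
        (fun j => (f.toFun g j : k)) (fun _ => rfl)] at h1
    rw [Nat.card_eq_fintype_card, mul_comm, ← h1, mul_comm]
  choose c hc using fun g =>
    IsAlgClosed.exists_pow_nat_eq (algebraMap k L (N g)) (Nat.card_pos (α := P))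
  refine ⟨c, fun g h => ?_, fun g h0 => ?_, fun g => ⟨N g, (hc g).symm⟩⟩
  · have : (c g * c h) ^ p ^ m = (algebraMap k L (f.toFun g h) * c (g * h)) ^ p ^ m := by
      rw [← hm, mul_pow, mul_pow, hc, hc, hc, ← map_pow, ← map_mul, ← map_mul, hN]
    exact iterateFrobenius_inj L p m this
  · have := hc g
    rw [h0, zero_pow Nat.card_pos.ne', eq_comm, map_eq_zero] at this
    exact hN0 g this

variable {f} {c : P → L} (hc : ∀ g h, c g * c h = algebraMap k L (f.toFun g h) * c (g * h))
  (hc0 : ∀ g, c g ≠ 0)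

/-- The character of a twisted group algebra defined by a splitting of the cocycle. -/
def character : CrossedProduct f →+* L :=
  liftHom f (algebraMap k L) c
    (mul_left_cancel₀ (hc0 1) (by rw [hc, mul_one, mul_comm]))
    (fun g s => by rw [ActsTrivially.smul_eq, mul_comm]) hc

theorem character_mono (g : P) (s : k) :
    character hc hc0 (mono f g s) = algebraMap k L s * c g := liftHom_mono ..

theorem character_coeffHom (s : k) :
    character hc hc0 (coeffHom f s) = algebraMap k L s := liftHom_coeffHom ..

/-- The comparison of a twisted group algebra with the untwisted one. -/
def toMonoidAlgebra : CrossedProduct f →+* MonoidAlgebra L P :=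
  liftHom f (MonoidAlgebra.singleOneRingHom.comp (algebraMap k L))
    (fun g => MonoidAlgebra.single g (c g))
    (by
      have : c 1 = algebraMap k L (f.toFun 1 1) :=
        mul_left_cancel₀ (hc0 1) (by rw [hc, mul_one, mul_comm])
      simp [this])
    (fun g s => by simp [ActsTrivially.smul_eq, mul_comm])
    (fun g h => by simp [hc])

theorem toMonoidAlgebra_mono (g : P) (s : k) :
    toMonoidAlgebra hc hc0 (mono f g s) = MonoidAlgebra.single g (algebraMap k L s * c g) := by
  rw [toMonoidAlgebra, liftHom_mono]
  simp

theorem toMonoidAlgebra_injective : Function.Injective (toMonoidAlgebra hc hc0) := by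
  classical
  have key : ∀ a g, (toMonoidAlgebra hc hc0 a).coeff g = algebraMap k L (coeff f g a) * c g := by
    intro a g
    induction a using CrossedProduct.induction with
    | h0 => simp
    | hadd x y hx hy => simp [hx, hy, add_mul]
    | hm h s =>
      rw [toMonoidAlgebra_mono, coeff_mono, MonoidAlgebra.coeff_single, Finsupp.single_apply]
      split_ifs with H
      · rw [H]
      · simp
  rw [injective_iff_map_eq_zero]
  intro a ha
  ext g
  have := key a g
  rw [ha] at this
  simpa [hc0 g] using this.symm

theorem lift_toMonoidAlgebra (a : CrossedProduct f) :
    MonoidAlgebra.lift L L P 1 (toMonoidAlgebra hc hc0 a) = character hc hc0 a := by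
  induction a using CrossedProduct.induction with
  | h0 => simp
  | hadd x y hx hy => simp [hx, hy]
  | hm g s =>
    rw [toMonoidAlgebra_mono, character_mono]
    simp

/-- The splitting embeds the twisted algebra in the group algebra over `L`, where the character
becomes the augmentation. -/
theorem eq_zero_of_mul_eq_zero_of_character_ne_zero [Finite P] {p : ℕ} [ExpChar L p] (hP : IsPGroup p P)
    {a b : CrossedProduct f}
    (ha : character hc hc0 a ≠ 0) (hb : b * a = 0) : b = 0 := by
  refine toMonoidAlgebra_injective hc hc0 ?_
  rw [map_zero]
  refine MonoidAlgebra.eq_zero_of_mul_eq_zero_of_isPGroup hP (a := toMonoidAlgebra hc hc0 a) ?_ ?_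
  · rwa [lift_toMonoidAlgebra]
  · rw [← map_mul, hb, map_zero]

/-- Raising to the power `|P|` is additive, as `|P|` is a power of the characteristic exponent;
monomials therefore suffice. -/
theorem character_pow_mem [Finite P] {p : ℕ} [ExpChar L p] (hP : IsPGroup p P)
    (h : ∀ g, c g ^ Nat.card P ∈ (algebraMap k L).range)
    (a : CrossedProduct f) : character hc hc0 a ^ Nat.card P ∈ (algebraMap k L).range := by
  obtain ⟨m, hm⟩ := hP.exists_card_eq_pow L
  rw [hm] at h ⊢
  induction a using CrossedProduct.induction with
  | h0 => rw [map_zero, zero_pow (pow_ne_zero _ (expChar_pos L p).ne')]; exact zero_mem _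
  | hadd x y hx hy => rw [map_add, add_pow_expChar_pow]; exact add_mem hx hy
  | hm g s =>
    rw [character_mono, mul_pow, ← map_pow]
    exact mul_mem ⟨_, rfl⟩ (h g)

end Character

end CrossedProduct

/-! ### Total ramification over the invariants -/

section Ramification

variable {S G : Type*} [CommRing S] [IsDomain S] [IsDiscreteValuationRing S] [Group G] [Finite G]
  [MulSemiringAction G S]

theorem IsDiscreteValuationRing.eq_zero_of_forall_pow_dvd {r x : S} (hr : ¬ IsUnit r)
    (h : ∀ k : ℕ, r ^ k ∣ x) : x = 0 := by
  by_contra hx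
  exact (FiniteMultiplicity.not_iff_forall.2 h) (FiniteMultiplicity.of_not_isUnit hr hx)

/-- If the residue field of the invariants is the whole residue field, then `S` is totally ramified
over the ring of invariants. -/
theorem pow_card_dvd_of_fixed [FaithfulSMul G S] {π : S} (hπ : Irreducible π)
    (hres : ∀ s : S, ∃ r, (∀ g : G, g • r = r) ∧
      IsLocalRing.residue S r = IsLocalRing.residue S s)
    {r : S} (hr : ∀ g : G, g • r = r) (hu : ¬ IsUnit r) : π ^ Nat.card G ∣ r := by
  cases nonempty_fintype G
  by_cases hr0 : r = 0
  · simp [hr0]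
  obtain ⟨e, u, hru⟩ := IsDiscreteValuationRing.eq_unit_mul_pow_irreducible hr0 hπ
  rw [hru, Units.dvd_mul_left]
  refine pow_dvd_pow _ ?_
  by_contra! he
  rw [Nat.card_eq_fintype_card] at he
  -- a nontrivial relation between the conjugates of the powers of `π`
  let φ : (G → S) →ₗ[S] (Fin e → S) :=
    { toFun := fun a i => ∑ g, a g * g • π ^ (i : ℕ)
      map_add' := fun a b => by ext i; simp [add_mul, Finset.sum_add_distrib]
      map_smul' := fun c a => by ext i; simp [Finset.mul_sum, mul_assoc] }
  obtain ⟨a, ha, ha0⟩ : ∃ a, φ a = 0 ∧ a ≠ 0 := by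
    by_contra! hinj
    have := card_le_of_injective S φ ((injective_iff_map_eq_zero φ).2 hinj)
    rw [Fintype.card_fin] at this
    omega
  -- `Λ` is linear over the invariants and kills `π ^ i` for `i < e`. Invariants represent all
  -- residue classes, so every element is an invariant combination of these powers modulo `π ^ e S =
  -- r S`. Hence `Λ(S) ⊆ r Λ(S)`, iteration gives `Λ = 0`, and this contradicts independence of the
  -- automorphisms.
  let Λ : S →+ S :=
    { toFun := fun s => ∑ g, a g * g • s
      map_zero' := by simp
      map_add' := fun s t => by simp [mul_add, Finset.sum_add_distrib] }
  have hΛ : ∀ s, Λ s = ∑ g, a g * g • s := fun s => rfl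
  have hΛπ : ∀ i < e, Λ (π ^ i) = 0 := fun i hi => congrFun ha ⟨i, hi⟩
  have hΛr : ∀ r, (∀ g : G, g • r = r) → ∀ s, Λ (r * s) = r * Λ s := fun r hr s => by
    rw [hΛ, hΛ, Finset.mul_sum]
    refine Finset.sum_congr rfl fun g _ => ?_
    rw [smul_mul', hr]; ring
  have hexp : ∀ i ≤ e, ∀ s, ∃ t, Λ s = Λ (π ^ i * t) := fun i => by
    induction i with
    | zero => exact fun _ s => ⟨s, by simp⟩
    | succ i ih =>
      intro hi s
      obtain ⟨t, ht⟩ := ih (by omega) s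
      obtain ⟨r, hr, hrt⟩ := hres t
      rw [eq_comm, ← sub_eq_zero, ← map_sub, IsLocalRing.residue_eq_zero_iff, hπ.maximalIdeal_eq,
        Ideal.mem_span_singleton] at hrt
      obtain ⟨t', ht'⟩ := hrt
      refine ⟨t', ?_⟩
      rw [ht, show π ^ i * t = r * π ^ i + π ^ (i + 1) * t' by linear_combination π ^ i * ht',
        map_add, hΛr r hr, hΛπ i (by omega), mul_zero, zero_add]
  have hdvd : ∀ k : ℕ, ∀ s, r ^ k ∣ Λ s := fun k => by
    induction k with
    | zero => simp
    | succ k ih =>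
      intro s
      obtain ⟨t, ht⟩ := hexp e le_rfl s
      rw [ht, show π ^ e * t = r * ((u⁻¹ : Sˣ) * t) by
        rw [hru]; linear_combination (-(π ^ e * t)) * u.mul_inv, hΛr r hr, pow_succ']
      exact mul_dvd_mul_left r (ih _)
  have hΛ0 : ∀ s, Λ s = 0 := fun s =>
    IsDiscreteValuationRing.eq_zero_of_forall_pow_dvd hu fun k => hdvd k s
  let χ : G → (S →* S) := fun g => (MulSemiringAction.toRingHom G S g).toMonoidHom
  have hχ : Function.Injective χ := fun g h H =>
    FaithfulSMul.eq_of_smul_eq_smul (α := S) fun x => DFunLike.congr_fun H x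
  have hli := (linearIndependent_monoidHom S S).comp χ hχ
  rw [Fintype.linearIndependent_iff] at hli
  exact ha0 (funext (hli a (by
    ext x
    simpa [χ, hΛ] using hΛ0 x)))

end Ramification

/-! ### The residue field of the inertia invariants -/

section Separable

variable {S G : Type*} [CommRing S] [IsLocalRing S] [Group G] [MulSemiringAction G S]

/-- The image in the residue field of the ring of invariants. -/
def fixedResidueSubfield (S G : Type*) [CommRing S] [IsLocalRing S] [Group G]
    [MulSemiringAction G S] : Subfield (IsLocalRing.ResidueField S) where
  __ := (FixedPoints.subring S G).map (IsLocalRing.residue S)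
  inv_mem' := by
    rintro _ ⟨r, hr, rfl⟩
    by_cases h : IsUnit r
    · obtain ⟨u, rfl⟩ := h
      refine ⟨(u⁻¹ : Sˣ), fun g => ?_, ?_⟩
      · have h1 : g • (u : S) = u := hr g
        refine u.isUnit.mul_left_cancel ?_
        rw [Units.mul_inv]
        nth_rw 1 [← h1]
        rw [← smul_mul', Units.mul_inv, smul_one]
      · rw [map_units_inv]
    · have : IsLocalRing.residue S r = 0 := (IsLocalRing.residue_eq_zero_iff r).2 h
      exact ⟨0, Subring.zero_mem _, by simp [this]⟩

theorem mem_fixedResidueSubfield {x : IsLocalRing.ResidueField S} :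
    x ∈ fixedResidueSubfield S G ↔ ∃ r, (∀ g : G, g • r = r) ∧ IsLocalRing.residue S r = x :=
  Iff.rfl

open Polynomial in
/-- The residue field of the ring of invariants of the inertia group is the whole residue field, in
the residually separable case. -/
theorem ResiduallySeparable.exists_fixed [Finite G] (hsep : ResiduallySeparable S G) (s : S) :
    ∃ r, (∀ g : inertiaGroup S G, g • r = r) ∧
      IsLocalRing.residue S r = IsLocalRing.residue S s := by
  rw [← mem_fixedResidueSubfield]
  set k := fixedResidueSubfield S (inertiaGroup S G) with hk
  set x := IsLocalRing.residue S s with hx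
  cases nonempty_fintype (inertiaGroup S G)
  -- `x` is separable over `k`
  let R := FixedPoints.subring S G
  let A := R ⧸ (IsLocalRing.maximalIdeal S).under R
  let j : A →+* k := (algebraMap A (S ⧸ IsLocalRing.maximalIdeal S)).codRestrict k (fun a => by
    obtain ⟨r, rfl⟩ := Ideal.Quotient.mk_surjective a
    exact ⟨r, fun g => r.2 g, rfl⟩)
  have hsx : IsSeparable k x := by
    have h1 : (@minpoly A (S ⧸ IsLocalRing.maximalIdeal S) _ _ _ x).Separable := hsep.isSeparable' _
    have h2 := h1.map (f := j)
    refine h2.of_dvd (minpoly.dvd _ _ ?_)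
    have h3 := @minpoly.aeval A (S ⧸ IsLocalRing.maximalIdeal S) _ _ _ x
    rw [aeval_def, eval₂_map]
    exact h3
  -- `x` is purely inseparable over `k`
  have hlift : (X - C x) ^ Fintype.card (inertiaGroup S G) ∈ lifts (algebraMap k _) := by
    -- All inertia conjugates of `s` reduce to `x`, while the coefficients of their characteristic
    -- polynomial are invariant.
    have h1 : (MulSemiringAction.charpoly (inertiaGroup S G) s).map (IsLocalRing.residue S) =
        (X - C x) ^ Fintype.card (inertiaGroup S G) := by
      rw [MulSemiringAction.charpoly_eq, Polynomial.map_prod, ← Finset.card_univ,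
        ← Finset.prod_const]
      refine Finset.prod_congr rfl fun g _ => ?_
      have : IsLocalRing.residue S (g • s) = x :=
        ActsTrivially.smul_eq g (IsLocalRing.residue S s)
      simp [this]
    rw [lifts_iff_coeff_lifts]
    intro n
    rw [← h1, coeff_map]
    exact ⟨⟨_, mem_fixedResidueSubfield.2
      ⟨_, fun g => MulSemiringAction.smul_coeff_charpoly s n g, rfl⟩⟩, rfl⟩
  obtain ⟨Q, hQ⟩ := hlift
  rw [coe_mapRingHom] at hQ
  have hdvd : (minpoly k x).map (algebraMap k _) ∣ (X - C x) ^ Fintype.card (inertiaGroup S G) := by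
    rw [← hQ]
    refine map_dvd (Polynomial.mapRingHom _) (minpoly.dvd _ _ ?_)
    rw [aeval_def, ← eval_map, hQ]
    simp
  obtain ⟨i, -, hi⟩ := (dvd_prime_pow (prime_X_sub_C x) _).1 hdvd
  -- Separability makes the minimal polynomial squarefree; dividing a power of `X - x`, it has
  -- degree one.
  have hsq : Squarefree ((minpoly k x).map (algebraMap k (IsLocalRing.ResidueField S))) :=
    (Polynomial.Separable.map (f := algebraMap k _) hsx).squarefree
  have hint : IsIntegral k x := IsSeparable.isIntegral hsx
  have hi1 : i ≤ 1 := by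
    by_contra! h
    have : (X - C x) * (X - C x) ∣ (minpoly k x).map (algebraMap k _) := by
      rw [← pow_two]
      exact (pow_dvd_pow _ h).trans hi.symm.dvd
    exact not_isUnit_X_sub_C x (hsq _ this)
  have hdeg : (minpoly k x).natDegree ≤ 1 := by
    rw [← natDegree_map (algebraMap k (IsLocalRing.ResidueField S)), natDegree_eq_of_degree_eq
      (degree_eq_degree_of_associated hi), natDegree_pow, natDegree_X_sub_C, mul_one]
    exact hi1
  obtain ⟨y, hy⟩ := minpoly.mem_range_of_degree_eq_one k x (by
    rw [degree_eq_natDegree (minpoly.ne_zero hint)]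
    have := minpoly.natDegree_pos hint
    norm_cast
    omega)
  rw [← hy]
  exact y.2

end Separable

/-! ### Heredity for the wild inertia group -/

namespace CrossedProduct

section LocalHereditary

attribute [local instance] leftModule in
theorem isNoetherianRing {S P : Type*} [CommRing S] [IsNoetherianRing S] [Group P] [Finite P]
    [MulSemiringAction P S] (f : TwoCocycle P S) : IsNoetherianRing (CrossedProduct f) := by
  have : IsScalarTower S (CrossedProduct f) (CrossedProduct f) :=
    ⟨fun s a b => mul_assoc (coeffHom f s) a b⟩
  have : Module.Finite S (CrossedProduct f) := Module.Finite.equiv (coordEquiv f).symm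
  exact isNoetherian_of_tower S inferInstance

variable {S P : Type*} [CommRing S] [IsDomain S] [IsDiscreteValuationRing S] [Group P] [Finite P]
  [MulSemiringAction P S] (f : TwoCocycle P S)

theorem ker_character_eq_bot [FaithfulSMul P S] [ActsTrivially P (IsLocalRing.ResidueField S)]
    {L : Type*} [Field L] [Algebra (IsLocalRing.ResidueField S) L] {p : ℕ} [ExpChar L p]
    (hP : IsPGroup p P) {c : P → L}
    (hc : ∀ g h, c g * c h = algebraMap _ L (f.residue.toFun g h).1 * c (g * h))
    (hc0 : ∀ g, c g ≠ 0)
    (hres : ∀ s : S, ∃ r, (∀ g : P, g • r = r) ∧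
      IsLocalRing.residue S r = IsLocalRing.residue S s)
    (hT : ∀ I : Submodule (CrossedProduct f) (CrossedProduct f),
      Module.Projective (CrossedProduct f) I)
    {z : CrossedProduct f.residue} (hz : character hc hc0 z = 0) : z = 0 := by
  classical
  cases nonempty_fintype P
  obtain ⟨π, hπ⟩ := IsDiscreteValuationRing.exists_irreducible S
  let χ : CrossedProduct f →+* L := (character hc hc0).comp (reduction f)
  have hχ : ∀ y, χ y = character hc hc0 (reduction f y) := fun _ => rfl
  have hunit : ∀ y, χ y ≠ 0 → ∃ b, b * y = 1 := fun y hy => by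
    -- Outside the kernel of `χ` the reduction is regular, so its norm over the residue field is
    -- nonzero and the norm over `S` is a unit.
    refine exists_mul_eq_one_of_isUnit_norm f ?_
    have h1 := norm_ne_zero f.residue (x := reduction f y) fun b hb =>
      eq_zero_of_mul_eq_zero_of_character_ne_zero hc hc0 hP hy hb
    rwa [norm_reduction, Ne, IsLocalRing.residue_eq_zero_iff, IsLocalRing.mem_maximalIdeal,
      mem_nonunits_iff, not_not] at h1
  let J : Submodule (CrossedProduct f) (CrossedProduct f) := RingHom.ker χ
  have hJ : ∀ y, y ∈ J ↔ χ y = 0 := fun y => RingHom.mem_ker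
  have hπJ : coeffHom f π ∈ J := by
    rw [hJ, hχ, (reduction_eq_zero_iff f hπ _).2 ⟨1, (one_mul _).symm⟩, map_zero]
  have hnu : ∀ y, χ y = 0 → ¬ IsUnit (norm f y) := fun y hy hu => by
    obtain ⟨b, hb⟩ := exists_mul_eq_one_of_isUnit_norm f hu
    have := congrArg χ hb
    rw [map_mul, hy, mul_zero, map_one] at this
    exact zero_ne_one this
  have hdvd : ∀ y, χ y = 0 → π ^ Nat.card P ∣ norm f y := fun y hy =>
    pow_card_dvd_of_fixed hπ hres (fun g => smul_norm f g y) (hnu y hy)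
  -- `σ` splits the canonical cover of `J` by a free module. Either one of its coordinates takes a
  -- value outside `J`, hence left invertible, and `J` is free on one generator; or all values lie
  -- in `J`.
  obtain ⟨σ, hσ⟩ := (hT J).out
  by_cases hcase : ∃ x y : J, χ (σ x y) ≠ 0
  · obtain ⟨x₀, y₀, hxy⟩ := hcase
    obtain ⟨b₀, hb₀⟩ := hunit _ hxy
    let φ : J →ₗ[CrossedProduct f] CrossedProduct f := Finsupp.lapply y₀ ∘ₗ σ
    obtain ⟨x, hφx⟩ : ∃ x, φ x = 1 := ⟨b₀ • x₀, by rw [map_smul]; exact hb₀⟩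
    have hN : norm f x.1 ≠ 0 := norm_ne_zero f fun b hb => by
      have h1 : b • x = 0 := Subtype.ext hb
      have := congrArg φ h1
      rwa [map_smul, hφx, smul_eq_mul, mul_one, map_zero] at this
    -- The difference `y'` is killed by `φ`, yet its multiple by the norm of `x` is `b • x`.
    -- Applying `φ` gives `b = 0`, so `y' = 0`.
    have hgen : ∀ y : J, y = φ y • x := fun y => by
      rw [← sub_eq_zero]
      set y' := y - φ y • x
      have hy' : φ y' = 0 := by rw [map_sub, map_smul, hφx, smul_eq_mul, mul_one, sub_self]
      obtain ⟨b, hb⟩ := exists_mul_eq_norm_mul f x.1 y'.1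
      have h1 : b • x = coeffHom f (norm f x.1) • y' := Subtype.ext hb
      have h2 := congrArg φ h1
      rw [map_smul, map_smul, hφx, hy', smul_zero, smul_eq_mul, mul_one] at h2
      rw [h2, zero_mul] at hb
      exact Subtype.ext (eq_zero_of_coeffHom_mul f hN _ hb.symm)
    obtain ⟨y, hy⟩ : ∃ y, coeffHom f π = y * x.1 :=
      ⟨_, congrArg Subtype.val (hgen ⟨_, hπJ⟩)⟩
    -- If `y` were in `J` too, the norm of `y * x` would have valuation at least `2 |P|`, but that
    -- of `π` has valuation `|P|`.
    have hχy : χ y ≠ 0 := fun h0 => by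
      have h1 := mul_dvd_mul (hdvd y h0) (hdvd x.1 ((hJ _).1 x.2))
      rw [← norm_mul, ← hy, norm_coeffHom] at h1
      choose w hw using fun g : P => hπ.exists_eq_mul_smul g
      have h2 : π ^ Nat.card P = (∏ g, (w g : S)) * ∏ g : P, g • π := by
        rw [← Finset.prod_mul_distrib, ← Finset.prod_congr rfl fun g _ => hw g, Finset.prod_const,
          Finset.card_univ, Nat.card_eq_fintype_card]
      have h3 := h1.trans (h2 ▸ Dvd.intro_left _ rfl)
      rw [← pow_add, pow_dvd_pow_iff hπ.ne_zero hπ.not_isUnit] at h3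
      have := Nat.card_pos (α := P)
      omega
    obtain ⟨b, hb⟩ := hunit y hχy
    obtain ⟨t, rfl⟩ := reduction_surjective f z
    rw [reduction_eq_zero_iff f hπ]
    have ht := congrArg Subtype.val (hgen ⟨t, (hJ t).2 hz⟩)
    refine ⟨φ ⟨t, (hJ t).2 hz⟩ * b, ?_⟩
    rw [hy, mul_assoc, ← mul_assoc b, hb, one_mul]
    exact ht
  · exfalso
    push Not at hcase
    have := isNoetherianRing f
    -- `χ (t * y + 1) = 1` for `y` in `J`, so `J` lies in the radical. With all coordinates in `J`,
    -- Nakayama gives `J = 0`, against `π ∈ J`.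
    have hJac : J ≤ Ring.jacobson (CrossedProduct f) := fun y hy => by
      rw [← Ideal.jacobson_bot, Ideal.mem_jacobson_iff]
      intro t
      obtain ⟨b, hb⟩ := hunit (t * y + 1) (by
        rw [map_add, map_mul, (hJ y).1 hy, mul_zero, zero_add, map_one]; exact one_ne_zero)
      exact ⟨b, by rw [Ideal.mem_bot, sub_eq_zero, ← hb, mul_add, mul_one, mul_assoc]⟩
    have hle : J ≤ Ring.jacobson (CrossedProduct f) • J := fun y hy => by
      have h1 := congrArg Subtype.val (hσ ⟨y, hy⟩)
      rw [← show _ = y from h1, Finsupp.linearCombination_apply, Finsupp.sum]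
      simp only [id_eq, AddSubmonoidClass.coe_finsetSum, SetLike.val_smul]
      exact Submodule.sum_mem _ fun i _ =>
        Submodule.smul_mem_smul (hJac ((hJ _).2 (hcase _ _))) i.2
    have hbot := (IsNoetherian.noetherian J).eq_bot_of_le_jacobson_smul hle
    rw [hbot, Submodule.mem_bot] at hπJ
    have := eq_zero_of_coeffHom_mul f hπ.ne_zero 1 (by rw [hπJ, zero_mul])
    have h2 := congrArg χ this
    rw [map_one, map_zero] at h2
    exact one_ne_zero h2

end LocalHereditary

end CrossedProduct

/-! ### Structure of twisted group algebras over a field -/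

namespace CrossedProduct

section Monomials

variable {k H : Type*} [Field k] [Group H] [MulSemiringAction H k] (f : TwoCocycle H k)

theorem exists_U_pow (g : H) (n : ℕ) : ∃ c : kˣ, U f g ^ n = coeffHom f c * U f (g ^ n) := by
  induction n with
  | zero =>
    refine ⟨(f.toFun 1 1)⁻¹, ?_⟩
    rw [pow_zero, pow_zero, U_one, ← map_mul, Units.inv_mul, map_one]
  | succ n ih =>
    obtain ⟨c, hc⟩ := ih
    exact ⟨c * f.toFun (g ^ n) g, by
      rw [pow_succ, hc, mul_assoc, U_mul_U, pow_succ, Units.val_mul, map_mul, mul_assoc]⟩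

theorem exists_U_mul (g h : H) : ∃ c : kˣ, U f (g * h) = coeffHom f c * (U f g * U f h) :=
  ⟨(f.toFun g h)⁻¹, by rw [U_mul_U, ← mul_assoc, ← map_mul, Units.inv_mul, map_one, one_mul]⟩

theorem mul_comm_of_commute_U {g h : H} (hgh : U f g * U f h = U f h * U f g) :
    g * h = h * g := by
  by_contra hne
  rw [U_mul_U, U_mul_U] at hgh
  have := congrArg (coeff f (g * h)) hgh
  rw [coeff_coeffHom_mul, coeff_coeffHom_mul, U, U, coeff_mono_self,
    coeff_mono_of_ne f (Ne.symm hne)] at this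
  simp at this

end Monomials

section TwistedGroupAlgebra

variable {k H : Type*} [Field k] [Group H] [MulSemiringAction H k] [ActsTrivially H k]
  (f : TwoCocycle H k)

/-- The coordinates of a twisted group algebra with respect to the basis `U_g`. -/
def algCoordEquiv : CrossedProduct f ≃ₗ[k] (H →₀ k) where
  toFun a := a
  invFun a := a
  left_inv _ := rfl
  right_inv _ := rfl
  map_add' _ _ := rfl
  map_smul' s a := Finsupp.ext fun g => (congrArg (coeff f g) (Algebra.smul_def s a)).trans
    (coeff_coeffHom_mul f s a g)

instance [Finite H] : Module.Finite k (CrossedProduct f) :=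
  Module.Finite.equiv (algCoordEquiv f).symm

theorem finrank_eq_card [Finite H] : Module.finrank k (CrossedProduct f) = Nat.card H := by
  cases nonempty_fintype H
  rw [(algCoordEquiv f).finrank_eq, Module.finrank_finsupp_self, Nat.card_eq_fintype_card]

/-- A twisted group algebra of a `p`-group with a faithful character is a purely inseparable field
extension. -/
theorem isField_and_isPurelyInseparable [Finite H] {L : Type*} [Field L] [Algebra k L] {p : ℕ}
    [ExpChar k p] (hP : IsPGroup p H) {c : H → L}
    (hc : ∀ g h, c g * c h = algebraMap k L (f.toFun g h) * c (g * h)) (hc0 : ∀ g, c g ≠ 0)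
    (hcp : ∀ g, c g ^ Nat.card H ∈ (algebraMap k L).range)
    (hinj : ∀ z, character hc hc0 z = 0 → z = 0) :
    IsField (CrossedProduct f) ∧ IsPurelyInseparable k (CrossedProduct f) := by
  have := expChar_of_injective_algebraMap (algebraMap k L).injective p
  have hinj' := (injective_iff_map_eq_zero (character hc hc0)).2 hinj
  have hpow : ∀ a : CrossedProduct f, ∃ s, a ^ Nat.card H = coeffHom f s := fun a => by
    obtain ⟨s, hs⟩ := character_pow_mem hc hc0 hP hcp a
    exact ⟨s, hinj' (by rw [map_pow, ← hs, character_coeffHom])⟩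
  have hF : IsField (CrossedProduct f) :=
    { exists_pair_ne := ⟨0, 1, fun h => by
        have := congrArg (character hc hc0) h
        rw [map_zero, map_one] at this
        exact zero_ne_one this⟩
      mul_comm := fun a b => hinj' (by rw [map_mul, map_mul, mul_comm])
      mul_inv_cancel := fun {a} ha => by
        obtain ⟨s, hs⟩ := hpow a
        have hs0 : s ≠ 0 := by
          rintro rfl
          have := congrArg (character hc hc0) hs
          rw [map_zero, map_zero, map_pow] at this
          exact ha (hinj a (pow_eq_zero_iff Nat.card_pos.ne' |>.1 this))
        refine ⟨a ^ (Nat.card H - 1) * coeffHom f s⁻¹, ?_⟩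
        rw [← mul_assoc, ← pow_succ', Nat.sub_add_cancel Nat.card_pos, hs, ← map_mul,
          mul_inv_cancel₀ hs0, map_one] }
  refine ⟨hF, ?_⟩
  let _ := hF.toField
  obtain ⟨m, hm⟩ := hP.exists_card_eq_pow k
  exact (isPurelyInseparable_iff_pow_mem k p).2 fun x => ⟨m, by
    obtain ⟨s, hs⟩ := hpow x
    rw [hm] at hs
    exact ⟨s, hs.symm⟩⟩

variable (P : Subgroup H)

/-- The inclusion of the twisted group algebra of a subgroup, as an algebra homomorphism. -/
def inclAlgHom : CrossedProduct (f.res P) →ₐ[k] CrossedProduct f :=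
  { inclHom f P with commutes' := fun s => inclHom_coeffHom f P s }

variable {P}

/-- An element normalizing `P` centralizes the twisted group algebra of `P` if this is a purely
inseparable field extension. -/
theorem commute_U_inclHom [P.Normal] (hF : IsField (CrossedProduct (f.res P)))
    (hp : IsPurelyInseparable k (CrossedProduct (f.res P))) (σ : H)
    (x : CrossedProduct (f.res P)) : Commute (U f σ) (inclHom f P x) := by
  have hy : ∀ x : CrossedProduct (f.res P), ∃ y, SemiconjBy (U f σ) (inclHom f P x)
      (inclHom f P y) := fun x => by
    induction x using CrossedProduct.induction with
    | h0 => exact ⟨0, by rw [map_zero]; exact SemiconjBy.zero_right _⟩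
    | hadd a b ha hb =>
      obtain ⟨a', ha⟩ := ha
      obtain ⟨b', hb⟩ := hb
      exact ⟨a' + b', by rw [map_add, map_add]; exact ha.add_right hb⟩
    | hm τ s =>
      let τ' : P := ⟨σ * τ * σ⁻¹, ‹P.Normal›.conj_mem τ τ.2 σ⟩
      have hτ' : (τ' : H) * σ = σ * τ := by simp [τ']
      refine ⟨mono _ τ' (s * f.toFun σ τ * ((f.toFun τ' σ)⁻¹ : kˣ)), ?_⟩
      rw [SemiconjBy, inclHom_mono, inclHom_mono, U, mono_mul_mono, mono_mul_mono, hτ']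
      congr 1
      rw [ActsTrivially.smul_eq, ActsTrivially.smul_eq]
      have := Units.inv_mul (f.toFun τ' σ)
      linear_combination (-(s * f.toFun σ τ)) * this
  -- `y` is the conjugate of `x` by `U_σ`. Some `p ^ n`-th power of `x` is a central scalar, so it
  -- is also that of `y`, and Frobenius is injective.
  obtain ⟨y, hy⟩ := hy x
  suffices h : y = x by rwa [h] at hy
  let _ := hF.toField
  obtain ⟨p, hpk⟩ := ExpChar.exists k
  have := expChar_of_injective_algebraMap (algebraMap k (CrossedProduct (f.res P))).injective p
  obtain ⟨n, s, hs⟩ := (isPurelyInseparable_iff_pow_mem k p).1 hp x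
  have h1 : SemiconjBy (U f σ) (inclHom f P (x ^ p ^ n)) (inclHom f P (y ^ p ^ n)) := by
    have := hy.pow_right (p ^ n)
    rw [← map_pow, ← map_pow] at this
    exact this
  rw [← hs] at h1
  have h2 : Commute (U f σ) (inclHom f P (algebraMap k _ s)) :=
    ((inclAlgHom f P).commutes s).symm ▸ Algebra.commute_algebraMap_right s (U f σ)
  have h3 : y ^ p ^ n = algebraMap k _ s :=
    inclHom_injective f P ((isUnit_U f σ).mul_right_cancel (h1.eq.symm.trans h2.eq))
  rw [hs] at h3
  exact iterateFrobenius_inj _ p n h3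

end TwistedGroupAlgebra

end CrossedProduct

namespace CrossedProduct

section Structure

variable {k H : Type*} [Field k] [Group H] [MulSemiringAction H k] [ActsTrivially H k]
  (f : TwoCocycle H k) {P : Subgroup H}

/-- If `H` is generated by `P` and `σ` modulo commutation relations, then the twisted group algebra
is generated by that of `P` and `U_σ`. -/
theorem adjoin_eq_top [Finite H] {σ : H} (hgen : ∀ g : H, ∃ τ ∈ P, ∃ i : ℕ, g = τ * σ ^ i) :
    Algebra.adjoin k (Set.range (inclHom f P) ∪ {U f σ}) = ⊤ := by
  cases nonempty_fintype H
  rw [eq_top_iff]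
  rintro a -
  set A := Algebra.adjoin k (Set.range (inclHom f P) ∪ {U f σ}) with hA
  have hcoef : ∀ s, coeffHom f s ∈ A := fun s => A.algebraMap_mem s
  have hσ : U f σ ∈ A := Algebra.subset_adjoin (Or.inr rfl)
  have hU : ∀ g, U f g ∈ A := fun g => by
    obtain ⟨τ, hτ, i, rfl⟩ := hgen g
    obtain ⟨c, hc⟩ := exists_U_mul f τ (σ ^ i)
    obtain ⟨d, hd⟩ := exists_U_pow f σ i
    have h1 : U f (σ ^ i) = coeffHom f (d⁻¹ : kˣ) * U f σ ^ i := by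
      rw [hd, ← mul_assoc, ← map_mul, Units.inv_mul, map_one, one_mul]
    rw [hc, h1]
    refine A.mul_mem (hcoef _) (A.mul_mem (Algebra.subset_adjoin (Or.inl ?_))
      (A.mul_mem (hcoef _) (pow_mem hσ i)))
    exact ⟨U _ ⟨τ, hτ⟩, inclHom_U f P ⟨τ, hτ⟩⟩
  rw [← sum_mono_coeff f a]
  exact sum_mem fun g _ => by rw [mono_eq]; exact A.mul_mem (hcoef _) (hU g)

/-- The structure of a twisted group algebra of a group which is generated by a normal subgroup `P`,
whose twisted group algebra is a purely inseparable field extension, and one further element. -/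
theorem exists_algEquiv_binomialAlgebra [Finite H] [P.Normal] (hF : IsField (CrossedProduct (f.res P)))
    (hp : IsPurelyInseparable k (CrossedProduct (f.res P))) {σ : H}
    (hgen : ∀ g : H, ∃ τ ∈ P, ∃ i : ℕ, g = τ * σ ^ i)
    (hdisj : Disjoint P (Subgroup.zpowers σ)) :
    ∃ α : kˣ, (∀ a b : H, a * b = b * a) ∧
      (∃ e : P × Subgroup.zpowers σ ≃* H, ∀ x, e x = x.1 * x.2) ∧
      ∃ φ : CrossedProduct f ≃ₐ[k] BinomialAlgebra hF (orderOf σ) (algebraMap _ _ α.1),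
        letI := hF.toField
        (∀ x : CrossedProduct (f.res P), φ (inclHom _ _ x) = AdjoinRoot.of _ x) ∧
        φ (U _ σ) = AdjoinRoot.root _ := by
  have hcomm : ∀ a ∈ (Set.range (inclHom f P) ∪ {U f σ}),
      ∀ b ∈ (Set.range (inclHom f P) ∪ {U f σ}), a * b = b * a := by
    rintro _ (⟨x, rfl⟩ | rfl) _ (⟨y, rfl⟩ | rfl)
    · rw [← map_mul, ← map_mul, hF.mul_comm]
    · exact (commute_U_inclHom f hF hp σ x).eq.symm
    · exact (commute_U_inclHom f hF hp σ y).eq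
    · rfl
  have htop := adjoin_eq_top f hgen
  have hmul : ∀ a b : CrossedProduct f, a * b = b * a := fun a b => by
    have h := (Algebra.isMulCommutative_adjoin k hcomm).is_comm.comm (⟨a, htop ▸ Algebra.mem_top⟩ : Algebra.adjoin k _)
      (⟨b, htop ▸ Algebra.mem_top⟩ : Algebra.adjoin k _)
    exact congrArg Subtype.val h
  have hab : ∀ a b : H, a * b = b * a := fun a b => mul_comm_of_commute_U f (hmul _ _)
  -- This power of `U_σ` is `c U_1 = c f(1,1)`, the scalar `α`; the second factor appears because
  -- the cocycle is not normalized.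
  obtain ⟨c, hc⟩ := exists_U_pow f σ (orderOf σ)
  rw [pow_orderOf_eq_one, U_one, ← map_mul] at hc
  let e₀ : P × Subgroup.zpowers σ →* H :=
    { toFun := fun x => x.1 * x.2
      map_one' := by simp
      map_mul' := fun x y => by
        simp only [Prod.fst_mul, Prod.snd_mul, Subgroup.coe_mul]
        rw [mul_assoc, ← mul_assoc (y.1 : H), hab y.1 x.2]
        simp only [mul_assoc] }
  have he₀ : Function.Bijective e₀ := by
    constructor
    · rw [injective_iff_map_eq_one]
      rintro ⟨x, y⟩ hxy
      have h1 : (x : H) * y = 1 := hxy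
      have hx : (x : H) ∈ Subgroup.zpowers σ := by
        rw [mul_eq_one_iff_eq_inv.1 h1]
        exact inv_mem y.2
      have hx1 : x = 1 := Subtype.ext (Subgroup.disjoint_def.1 hdisj x.2 hx)
      subst hx1
      refine Prod.ext rfl (Subtype.ext ?_)
      simpa using h1
    · intro g
      obtain ⟨τ, hτ, i, rfl⟩ := hgen g
      exact ⟨(⟨τ, hτ⟩, ⟨σ ^ i, Subgroup.npow_mem_zpowers σ i⟩), rfl⟩
  have hcard : Nat.card H = Nat.card P * orderOf σ := by
    rw [← Nat.card_congr (Equiv.ofBijective e₀ he₀), Nat.card_prod, Nat.card_zpowers]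
  refine ⟨c * f.toFun 1 1, hab, ⟨MulEquiv.ofBijective e₀ he₀, fun _ => rfl⟩, ?_⟩
  let _ : Field (CrossedProduct (f.res P)) := hF.toField
  let _ : CommRing (CrossedProduct f) :=
    { (inferInstance : Ring (CrossedProduct f)) with mul_comm := hmul }
  let q : Polynomial (CrossedProduct (f.res P)) :=
    Polynomial.X ^ orderOf σ - Polynomial.C (algebraMap k _ (c * f.toFun 1 1 : kˣ))
  have hq : q.Monic := Polynomial.monic_X_pow_sub_C _ (orderOf_pos σ).ne'
  have hroot : q.eval₂ (inclAlgHom f P : CrossedProduct (f.res P) →+* CrossedProduct f) (U f σ) = 0 := by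
    simp only [q, Polynomial.eval₂_sub, Polynomial.eval₂_X_pow, Polynomial.eval₂_C]
    rw [hc, sub_eq_zero]
    exact ((inclAlgHom f P).commutes _).symm
  let ψ : AdjoinRoot q →ₐ[k] CrossedProduct f :=
    AdjoinRoot.liftAlgHom q (inclAlgHom f P) (U f σ) hroot
  have hψo : ∀ x, ψ (AdjoinRoot.of q x) = inclHom f P x := fun x => AdjoinRoot.lift_of hroot
  have hψr : ψ (AdjoinRoot.root q) = U f σ := AdjoinRoot.lift_root hroot
  have hsurj : Function.Surjective ψ := by
    rw [← AlgHom.range_eq_top, eq_top_iff, ← htop]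
    refine Algebra.adjoin_le ?_
    rintro _ (⟨x, rfl⟩ | rfl)
    · exact ⟨_, hψo x⟩
    · exact ⟨_, hψr⟩
  -- Both dimensions are `|P|` times the order of `σ`, so the surjection `ψ` is bijective.
  have hfin : Module.finrank k (AdjoinRoot q) = Module.finrank k (CrossedProduct f) := by
    have := hq.finite_adjoinRoot
    rw [finrank_eq_card, hcard,
      ← Module.finrank_mul_finrank k (CrossedProduct (f.res P)) (AdjoinRoot q),
      finrank_eq_card, (AdjoinRoot.powerBasis' hq).finrank, AdjoinRoot.powerBasis'_dim,
      Polynomial.natDegree_X_pow_sub_C]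
  have : Module.Finite k (AdjoinRoot q) := by
    have := hq.finite_adjoinRoot
    exact Module.Finite.trans (CrossedProduct (f.res P)) _
  have hinj : Function.Injective ψ :=
    (LinearMap.injective_iff_surjective_of_finrank_eq_finrank (f := ψ.toLinearMap) hfin).2 hsurj
  let Ψ := AlgEquiv.ofBijective ψ ⟨hinj, hsurj⟩
  refine ⟨Ψ.symm, fun x => ?_, ?_⟩
  · exact Ψ.symm_apply_eq.2 (hψo x).symm
  · exact Ψ.symm_apply_eq.2 hψr.symm

end Structure

end CrossedProduct

/-! ### The tame character and the complement of wild inertia -/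

section Tame

variable {S G : Type*} [CommRing S] [IsDomain S] [IsDiscreteValuationRing S] [Group G]
  [MulSemiringAction G S]

theorem residue_smul_of_actsTrivially [ActsTrivially G (IsLocalRing.ResidueField S)] (g : G)
    (s : S) : IsLocalRing.residue S (g • s) = IsLocalRing.residue S s :=
  ActsTrivially.smul_eq g (IsLocalRing.residue S s)

/-- The tame character of a group of automorphisms acting trivially on the residue field: the class
of `g π / π`. -/
theorem exists_tameCharacter [ActsTrivially G (IsLocalRing.ResidueField S)] {π : S}
    (hπ : Irreducible π) : ∃ θ : G →* (IsLocalRing.ResidueField S)ˣ, ∀ g, ∃ w : Sˣ,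
      g • π = w * π ∧ IsLocalRing.residue S w = θ g := by
  have hw : ∀ g : G, ∃ w : Sˣ, g • π = w * π := fun g => by
    obtain ⟨w, h⟩ := hπ.exists_eq_mul_smul g
    exact ⟨w⁻¹, by conv_rhs => rw [h]
                   rw [Units.inv_mul_cancel_left]⟩
  choose w hw using hw
  refine ⟨{ toFun := fun g => Units.map (IsLocalRing.residue S).toMonoidHom (w g)
            map_one' := ?_, map_mul' := fun g h => ?_ }, fun g => ⟨w g, hw g, rfl⟩⟩
  · ext
    have h1 : (w 1 : S) = 1 := by
      have := hw 1
      rw [one_smul] at this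
      exact mul_right_cancel₀ hπ.ne_zero (by rw [← this, one_mul])
    simp [h1]
  · ext
    have h1 : (w (g * h) : S) = g • (w h : S) * w g := by
      refine mul_right_cancel₀ hπ.ne_zero ?_
      rw [← hw, mul_smul, hw h, smul_mul', hw g, mul_assoc]
    simp only [RingHom.toMonoidHom_eq_coe, Units.coe_map, MonoidHom.coe_coe, Units.val_mul]
    rw [h1, map_mul, residue_smul_of_actsTrivially, mul_comm]

/-- Elements of order prime to the residue characteristic in the kernel of the tame character are
trivial. -/
theorem eq_one_of_tameCharacter_eq_one [FaithfulSMul G S]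
    [ActsTrivially G (IsLocalRing.ResidueField S)] {π : S} (hπ : Irreducible π)
    {θ : G →* (IsLocalRing.ResidueField S)ˣ}
    (hθ : ∀ g, ∃ w : Sˣ, g • π = w * π ∧ IsLocalRing.residue S w = θ g) {g : G} (hg : θ g = 1)
    {m : ℕ} (hm : g ^ m = 1) (hm0 : (m : IsLocalRing.ResidueField S) ≠ 0) : g = 1 := by
  obtain ⟨v, hv⟩ : IsUnit (m : S) := by
    rwa [← map_natCast (IsLocalRing.residue S), Ne, IsLocalRing.residue_eq_zero_iff,
      IsLocalRing.mem_maximalIdeal, mem_nonunits_iff, not_not] at hm0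
  -- `A` averages over the powers of `g` and preserves residues. As `g ^ j π / π` reduces to `1`, `A
  -- π` is a `g`-invariant uniformizer. Writing `s = A s + A π * t` gives `g s - s = A π (g t - t)`,
  -- so `g s - s` is divisible by every power of `A π`.
  obtain ⟨A, hAdef⟩ : ∃ A : S → S, ∀ s, A s = (v⁻¹ : Sˣ) * ∑ j ∈ Finset.range m, g ^ j • s :=
    ⟨_, fun _ => rfl⟩
  have hvfix : g • ((v⁻¹ : Sˣ) : S) = (v⁻¹ : Sˣ) := by
    refine v.isUnit.mul_left_cancel ?_
    have : g • (v : S) = v := by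
      rw [hv]; exact map_natCast (MulSemiringAction.toRingHom G S g) m
    rw [Units.mul_inv]
    nth_rw 1 [← this]
    rw [← smul_mul', Units.mul_inv, smul_one]
  have hA : ∀ s, g • A s = A s := fun s => by
    simp only [hAdef, smul_mul', hvfix, Finset.smul_sum, smul_smul, ← pow_succ']
    have h1 := Finset.sum_range_succ (fun j => g ^ j • s) m
    rw [Finset.sum_range_succ', hm, pow_zero] at h1
    rw [add_right_cancel h1]
  have hAres : ∀ s, IsLocalRing.residue S (A s) = IsLocalRing.residue S s := fun s => by
    simp only [hAdef, map_mul, map_sum, residue_smul_of_actsTrivially, Finset.sum_const,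
      Finset.card_range, nsmul_eq_mul]
    rw [← map_natCast (IsLocalRing.residue S), ← hv, ← mul_assoc, ← map_mul, Units.inv_mul, map_one,
      one_mul]
  choose w hw using hθ
  obtain ⟨u, hu⟩ : ∃ u : Sˣ, A π = u * π := by
    have h1 : A π = ((v⁻¹ : Sˣ) * ∑ j ∈ Finset.range m, (w (g ^ j) : S)) * π := by
      simp only [hAdef, (hw _).1, mul_assoc, Finset.sum_mul]
    have h2 : IsLocalRing.residue S ((v⁻¹ : Sˣ) * ∑ j ∈ Finset.range m, (w (g ^ j) : S)) = 1 := by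
      simp only [map_mul, map_sum, (hw _).2, map_pow, hg, one_pow, Units.val_one, Finset.sum_const,
        Finset.card_range, nsmul_eq_mul, mul_one]
      rw [← map_natCast (IsLocalRing.residue S), ← hv, ← map_mul, Units.inv_mul, map_one]
    obtain ⟨u, hu⟩ : IsUnit (((v⁻¹ : Sˣ) : S) * ∑ j ∈ Finset.range m, (w (g ^ j) : S)) := by
      by_contra hnu
      rw [← mem_nonunits_iff, ← IsLocalRing.mem_maximalIdeal, ← IsLocalRing.residue_eq_zero_iff,
        h2] at hnu
      exact one_ne_zero hnu
    exact ⟨u, by rw [h1, hu]⟩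
  have hdvd : ∀ k : ℕ, ∀ s, A π ^ k ∣ g • s - s := fun k => by
    induction k with
    | zero => simp
    | succ k ih =>
      intro s
      obtain ⟨t, ht⟩ : ∃ t, s - A s = A π * t := by
        have h1 := hAres s
        rw [eq_comm, ← sub_eq_zero, ← map_sub, IsLocalRing.residue_eq_zero_iff, hπ.maximalIdeal_eq,
          Ideal.mem_span_singleton] at h1
        rwa [← Units.mul_left_dvd (u := u), ← hu] at h1
      have hs : s = A s + A π * t := by rw [← ht]; ring
      have h1 : g • s - s = A π * (g • t - t) := by
        nth_rw 1 2 [hs]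
        rw [smul_add, smul_mul', hA, hA]
        ring
      rw [h1, pow_succ']
      exact mul_dvd_mul_left _ (ih t)
  refine FaithfulSMul.eq_of_smul_eq_smul (α := S) fun s => ?_
  rw [one_smul, ← sub_eq_zero]
  refine IsDiscreteValuationRing.eq_zero_of_forall_pow_dvd (r := A π) ?_ fun k => hdvd k s
  rw [hu, Units.isUnit_units_mul]
  exact hπ.not_isUnit

theorem eq_one_of_pow_expChar_pow_eq_one {k : Type*} [Field k] {p : ℕ} [ExpChar k p] {x : kˣ} (n : ℕ)
    (h : x ^ p ^ n = 1) : x = 1 := by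
  refine Units.ext (iterateFrobenius_inj k p n ?_)
  rw [iterateFrobenius_def, iterateFrobenius_def, ← Units.val_pow_eq_pow_val, h, Units.val_one,
    one_pow]

/-- A field of characteristic exponent `p` has no nontrivial `p`-power roots of unity, so a factor
`p` could be dropped from the order. -/
theorem orderOf_coprime_expChar {k : Type*} [Field k] {p : ℕ} [hp : ExpChar k p] {x : kˣ}
    (hx : IsOfFinOrder x) : (orderOf x).Coprime p := by
  have key : ∀ e, orderOf x = p * e → orderOf x ∣ e := fun e he => by
    refine orderOf_dvd_of_pow_eq_one (eq_one_of_pow_expChar_pow_eq_one (p := p) 1 ?_)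
    rw [pow_one, ← pow_mul, mul_comm, ← he, pow_orderOf_eq_one]
  rcases hp with _ | hp
  · exact Nat.coprime_one_right _
  · rw [Nat.coprime_comm, hp.coprime_iff_not_dvd]
    rintro ⟨e, he⟩
    have h2 := key e he
    have h3 := hx.orderOf_pos
    rw [he] at h2 h3
    have he0 : 0 < e := Nat.pos_of_mul_pos_left h3
    exact absurd (Nat.le_of_dvd he0 h2) (by nlinarith [hp.two_le])

/-- The wild inertia group is the kernel of the tame character. -/
theorem sylow_eq_ker_tameCharacter [Finite G] [FaithfulSMul G S]
    [ActsTrivially G (IsLocalRing.ResidueField S)] {π : S} (hπ : Irreducible π)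
    {θ : G →* (IsLocalRing.ResidueField S)ˣ}
    (hθ : ∀ g, ∃ w : Sˣ, g • π = w * π ∧ IsLocalRing.residue S w = θ g) {p : ℕ}
    [hp : ExpChar (IsLocalRing.ResidueField S) p] (P : Sylow p G) : (P : Subgroup G) = θ.ker := by
  -- Maximality of `P`: the kernel is a `p`-group, because the prime-to-`p` part of each element is
  -- trivial, and it contains `P`, because the target has no `p`-torsion.
  refine (P.is_maximal' (Q := θ.ker) ?_ ?_).symm
  · rintro ⟨g, hg⟩
    have hg' : θ g = 1 := hg
    rcases hp with _ | hp
    · refine ⟨0, Subtype.ext ?_⟩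
      rw [pow_zero, pow_one]
      exact eq_one_of_tameCharacter_eq_one hπ hθ hg' (pow_orderOf_eq_one g)
        (Nat.cast_ne_zero.2 (orderOf_pos g).ne')
    · obtain ⟨a, m, hm, hgm⟩ := Nat.exists_eq_pow_mul_and_not_dvd (orderOf_pos g).ne' p hp.ne_one
      refine ⟨a, Subtype.ext ?_⟩
      refine eq_one_of_tameCharacter_eq_one hπ hθ (g := g ^ p ^ a) (by rw [map_pow, hg', one_pow])
        (m := m) (by rw [← pow_mul, ← hgm, pow_orderOf_eq_one]) ?_
      rwa [Ne, CharP.cast_eq_zero_iff _ p]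
  · intro g hg
    obtain ⟨n, hn⟩ := P.2 ⟨g, hg⟩
    have hn' : g ^ p ^ n = 1 := congrArg Subtype.val hn
    exact eq_one_of_pow_expChar_pow_eq_one (p := p) n (by rw [← map_pow, hn', map_one])

/-- A complement of the wild inertia group is generated by one element of order prime to the residue
characteristic. -/
theorem exists_tame_generator [Finite G] [FaithfulSMul G S]
    [ActsTrivially G (IsLocalRing.ResidueField S)] {p : ℕ}
    [hp : ExpChar (IsLocalRing.ResidueField S) p] (P : Sylow p G) :
    (P : Subgroup G).Normal ∧ ∃ σ : G, (orderOf σ).Coprime p ∧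
      (∀ g : G, ∃ τ ∈ (P : Subgroup G), ∃ i : ℕ, g = τ * σ ^ i) ∧
      Disjoint (P : Subgroup G) (Subgroup.zpowers σ) := by
  obtain ⟨π, hπ⟩ := IsDiscreteValuationRing.exists_irreducible S
  obtain ⟨θ, hθ⟩ := exists_tameCharacter (G := G) hπ
  have hP := sylow_eq_ker_tameCharacter hπ hθ P
  refine ⟨hP ▸ inferInstance, ?_⟩
  have : Finite θ.range := Finite.of_surjective _ θ.rangeRestrict_surjective
  have : IsCyclic θ.range :=
    isCyclic_of_injective_ringHom ((Units.coeHom (IsLocalRing.ResidueField S)).comp θ.range.subtype)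
      (Units.val_injective.comp Subtype.val_injective)
  obtain ⟨⟨_, σ, rfl⟩, hσ⟩ := IsCyclic.exists_generator (α := θ.range)
  obtain ⟨n, hn⟩ := P.2.exists_card_eq_pow (IsLocalRing.ResidueField S)
  have hfin : IsOfFinOrder (θ σ) := θ.isOfFinOrder (isOfFinOrder_of_finite σ)
  have hcop := orderOf_coprime_expChar (p := p) hfin
  -- Passing to `σ ^ p ^ n`, with `p ^ n = |P|`, removes the `p`-part of the order; its image still
  -- generates, since `p` is prime to the order of `θ σ`.
  have hord : (σ ^ p ^ n) ^ orderOf (θ σ) = 1 := by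
    have h1 : σ ^ orderOf (θ σ) ∈ (P : Subgroup G) := by
      rw [hP, MonoidHom.mem_ker, map_pow, pow_orderOf_eq_one]
    have h2 : (⟨_, h1⟩ : P) ^ Nat.card P = 1 := pow_card_eq_one'
    rw [← pow_mul, mul_comm, pow_mul, ← hn]
    exact congrArg Subtype.val h2
  have hord' := orderOf_dvd_of_pow_eq_one hord
  have hcop' : (orderOf (σ ^ p ^ n)).Coprime p := Nat.Coprime.coprime_dvd_left hord' hcop
  refine ⟨σ ^ p ^ n, hcop', fun g => ?_, ?_⟩
  · have h0 : θ g ∈ Subgroup.zpowers (θ σ) := by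
      obtain ⟨i, hi⟩ := Subgroup.mem_zpowers_iff.1 (hσ ⟨θ g, g, rfl⟩)
      exact Subgroup.mem_zpowers_iff.2 ⟨i, by simpa using congrArg Subtype.val hi⟩
    have h1 : θ g ∈ Submonoid.powers (θ (σ ^ p ^ n)) := by
      rw [(θ.isOfFinOrder (isOfFinOrder_of_finite (σ ^ p ^ n))).mem_powers_iff_mem_zpowers, map_pow]
      refine (Subgroup.zpowers_le.2 ?_) h0
      exact mem_zpowers_pow_iff.2 (Nat.Coprime.pow_left n hcop.symm)
    obtain ⟨i, hi⟩ := h1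
    refine ⟨g * ((σ ^ p ^ n) ^ i)⁻¹, ?_, i, by group⟩
    rw [hP, MonoidHom.mem_ker, map_mul, map_inv, map_pow, ← hi]
    exact mul_inv_cancel _
  · rw [Subgroup.disjoint_def]
    intro x hx hx'
    obtain ⟨m, hm⟩ := P.2 ⟨x, hx⟩
    have hm' : x ^ p ^ m = 1 := congrArg Subtype.val hm
    have h1 := orderOf_dvd_of_pow_eq_one hm'
    have h2 : orderOf x ∣ orderOf (σ ^ p ^ n) := orderOf_dvd_of_mem_zpowers hx'
    rw [← orderOf_eq_one_iff]
    exact Nat.eq_one_of_dvd_coprimes (hcop'.pow_right m) h2 h1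

end Tame

/-! ### Assembly of the theorem -/

/-- Subgroups of the inertia group act trivially on the residue field. -/
theorem actsTrivially_subgroup_inertiaGroup {S G : Type*} [CommRing S] [IsLocalRing S] [Group G]
    [MulSemiringAction G S] (P : Subgroup (inertiaGroup S G)) :
    @ActsTrivially P (IsLocalRing.ResidueField S)
      (@IsLocalRing.ResidueField.instMulSemiringAction S _ _ P _ _).toSMul :=
  inferInstanceAs (ActsTrivially P (IsLocalRing.ResidueField S))

/-- The action on the residue field can be restricted after reduction or induced from the restricted
action on `S`. The two agree definitionally, and triviality is needed for the second form as well.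
-/
theorem actsTrivially_inertiaGroup (S G : Type*) [CommRing S] [IsLocalRing S] [Group G]
    [MulSemiringAction G S] :
    @ActsTrivially (inertiaGroup S G) (IsLocalRing.ResidueField S)
      (@IsLocalRing.ResidueField.instMulSemiringAction S _ _ (inertiaGroup S G) _ _).toSMul :=
  inferInstanceAs (ActsTrivially (inertiaGroup S G) (IsLocalRing.ResidueField S))

open CrossedProduct in
/-- Left heredity forces the twisted group algebra of the wild inertia group to be a purely
inseparable field extension of the residue field. -/
theorem isField_subInertiaAlgebra {S G : Type*} [CommRing S] [IsDomain S]
    [IsDiscreteValuationRing S] [Group G] [Finite G] [MulSemiringAction G S] [FaithfulSMul G S]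
    (hsep : ResiduallySeparable S G) (f : TwoCocycle G S) {p : ℕ}
    [ExpChar (IsLocalRing.ResidueField S) p] {P : Subgroup (inertiaGroup S G)} (hP : IsPGroup p P)
    (hT : ∀ I : Submodule (CrossedProduct f) (CrossedProduct f),
      Module.Projective (CrossedProduct f) I) :
    IsField (SubInertiaAlgebra f P) ∧
      IsPurelyInseparable (IsLocalRing.ResidueField S) (SubInertiaAlgebra f P) := by
  let L := AlgebraicClosure (IsLocalRing.ResidueField S)
  have := expChar_of_injective_algebraMap (algebraMap (IsLocalRing.ResidueField S) L).injective p
  have := actsTrivially_subgroup_inertiaGroup P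
  let f' := (f.res (inertiaGroup S G)).res P
  have hT' := projective_res _ P (projective_res f (inertiaGroup S G) hT)
  have hres : ∀ s : S, ∃ r, (∀ g : P, g • r = r) ∧
      IsLocalRing.residue S r = IsLocalRing.residue S s := fun s => by
    obtain ⟨r, hr, hrs⟩ := hsep.exists_fixed s
    exact ⟨r, fun g => hr g, hrs⟩
  obtain ⟨c, hc, hc0, hcp⟩ := ((f.residue.res (inertiaGroup S G)).res P).exists_coboundary
    (L := L) hP
  exact isField_and_isPurelyInseparable _ hP hc hc0 hcp fun z hz =>
    ker_character_eq_bot f' hP hc hc0 hres hT' hz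

/-- The twisted group algebra of the inertia group is semisimple as soon as that of its wild part
is. -/
theorem isSemisimpleRing_inertiaAlgebra {k H : Type*} [Field k] [Group H] [Finite H]
    [MulSemiringAction H k] [ActsTrivially H k] (f : TwoCocycle H k) {P : Subgroup H}
    (hP : (P.index : k) ≠ 0) (hF : IsField (CrossedProduct (f.res P))) :
    IsSemisimpleRing (CrossedProduct f) := by
  have := Fintype.ofFinite (H ⧸ P)
  have : IsSemisimpleRing (CrossedProduct (f.res P)) := by
    let _ := hF.toField
    infer_instance
  refine CrossedProduct.isSemisimpleRing_of_res f P (P.index : k)⁻¹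
    (fun h _ => ActsTrivially.smul_eq h _) ?_
  simp only [ActsTrivially.smul_eq, Finset.sum_const, Finset.card_univ, nsmul_eq_mul]
  rw [← Nat.card_eq_fintype_card]
  exact mul_inv_cancel₀ hP

theorem Sylow.index_ne_zero {k : Type*} [Field k] {p : ℕ} [ExpChar k p] {H : Type*} [Group H]
    [Finite H] (P : Sylow p H) : ((P : Subgroup H).index : k) ≠ 0 := by
  rcases ‹ExpChar k p› with _ | hp
  · exact Nat.cast_ne_zero.2 Subgroup.FiniteIndex.index_ne_zero
  · have := Fact.mk hp
    rw [Ne, CharP.cast_eq_zero_iff k p]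
    exact P.not_dvd_index

theorem mainTheorem3 {S G : Type*} [CommRing S] [IsDomain S] [IsDiscreteValuationRing S]
    [Group G] [Finite G] [MulSemiringAction G S] [FaithfulSMul G S]
    (hsep : ResiduallySeparable S G) (f : TwoCocycle G S)
    -- `p` is the residue characteristic, or `1` if that is zero: then `P` is trivial and every integer
    -- is prime to `p`
    (p : ℕ) [ExpChar (IsLocalRing.ResidueField S) p] (P : Sylow p (inertiaGroup S G)) :
    (IsHereditaryRing (CrossedProduct f) ↔
      IsSemisimpleRing (InertiaAlgebra f) ∧
      ∃ hF : IsField (SubInertiaAlgebra f P),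
        IsPurelyInseparable (IsLocalRing.ResidueField S) (SubInertiaAlgebra f P) ∧
        ∃ (e₀ : ℕ) (α₀ : (IsLocalRing.ResidueField S)ˣ), 0 < e₀ ∧ e₀.Coprime p ∧
          Nonempty (InertiaAlgebra f ≃ₐ[IsLocalRing.ResidueField S]
            BinomialAlgebra hF e₀ (algebraMap _ _ α₀.1))) ∧
    (IsHereditaryRing (CrossedProduct f) →
      ∃ (hF : IsField (SubInertiaAlgebra f P)) (σ₀ : inertiaGroup S G)
        (α₀ : (IsLocalRing.ResidueField S)ˣ),
        (orderOf σ₀).Coprime p ∧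
        (∀ a b : inertiaGroup S G, a * b = b * a) ∧
        (∃ e : P × Subgroup.zpowers σ₀ ≃* inertiaGroup S G, ∀ x, e x = x.1 * x.2) ∧
        ∃ φ : InertiaAlgebra f ≃ₐ[IsLocalRing.ResidueField S]
            BinomialAlgebra hF (orderOf σ₀) (algebraMap _ _ α₀.1),
          letI := hF.toField
          (∀ x : SubInertiaAlgebra f P, φ (CrossedProduct.inclHom _ _ x) = AdjoinRoot.of _ x) ∧
          φ (CrossedProduct.U _ σ₀) = AdjoinRoot.root _) := by
  -- Both parts follow from this common statement, which also records pure inseparability for the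
  -- first one.
  have structure_of_hereditary : IsHereditaryRing (CrossedProduct f) →
      ∃ hF : IsField (SubInertiaAlgebra f P),
        IsPurelyInseparable (IsLocalRing.ResidueField S) (SubInertiaAlgebra f P) ∧
        ∃ (σ₀ : inertiaGroup S G) (α₀ : (IsLocalRing.ResidueField S)ˣ),
          (orderOf σ₀).Coprime p ∧
          (∀ a b : inertiaGroup S G, a * b = b * a) ∧
          (∃ e : P × Subgroup.zpowers σ₀ ≃* inertiaGroup S G, ∀ x, e x = x.1 * x.2) ∧
          ∃ φ : InertiaAlgebra f ≃ₐ[IsLocalRing.ResidueField S]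
              BinomialAlgebra hF (orderOf σ₀) (algebraMap _ _ α₀.1),
            letI := hF.toField
            (∀ x : SubInertiaAlgebra f P, φ (CrossedProduct.inclHom _ _ x) = AdjoinRoot.of _ x) ∧
            φ (CrossedProduct.U _ σ₀) = AdjoinRoot.root _ := fun hT => by
    obtain ⟨hF, hp⟩ := isField_subInertiaAlgebra hsep f P.2 hT.1
    have := actsTrivially_inertiaGroup S G
    obtain ⟨hN, σ, hσ, hgen, hdisj⟩ := exists_tame_generator (S := S) P
    obtain ⟨α, h⟩ := CrossedProduct.exists_algEquiv_binomialAlgebra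
      (f.residue.res (inertiaGroup S G)) hF hp hgen hdisj
    exact ⟨hF, hp, σ, α, hσ, h⟩
  refine ⟨⟨fun hT => ?_, fun h => CrossedProduct.isHereditaryRing_of_isSemisimpleRing f h.1⟩,
    fun hT => ?_⟩
  · obtain ⟨hF, hp, σ, α, hσ, -, -, φ, -⟩ := structure_of_hereditary hT
    exact ⟨isSemisimpleRing_inertiaAlgebra _ P.index_ne_zero hF, hF, hp, orderOf σ, α,
      orderOf_pos σ, hσ, ⟨φ⟩⟩
  · obtain ⟨hF, -, h⟩ := structure_of_hereditary hT
    exact ⟨hF, h⟩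

end
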